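/- Let $\mathfrak H$ be a real separable Hilbert space and let $X=\{X(h):h\in\mathfrak H\}$ be an isonormal Gaussian process over $\mathfrak H$ on a probability space $(\Omega,\mathscr F,P)$, i.e. a centered jointly Gaussian family with $\mathbb E[X(g)X(h)]=\langle g,h\rangle_{\mathfrak H}$. For $q\ge 1$ let $\mathscr H_q$ be the $q$-th Wiener chaos, the closed linear span in $L^2(\Omega)$ of the variables $H_q(X(h))$, $\|h\|_{\mathfrak H}=1$, where $H_q$ is the $q$-th (probabilists') Hermite polynomial, and let $J_q$ be the orthogonal projection of $L^2(\Omega)$ onto $\mathscr H_q$. Let $I_2$ be the double Wiener–Itô integral, i.e. the continuous linear map $\mathfrak H^{\odot 2}\to L^2(\Omega)$ on the symmetric tensor product with $I_2(h\otimes h)=H_2(X(h))=X(h)^2-1$ for $\|h\|_{\mathfrak H}=1$. Let $D:\mathbb D^{1,2}\subset L^2(\Omega)\to L^2(\Omega;\mathfrak H)$ be the Malliavin derivative, i.e. the closure of the operator $g(X(\varphi_1),\dots,X(\varphi_n))\mapsto\sum_{i=1}^n\partial_i g(X(\varphi_1),\dots,X(\varphi_n))\,\varphi_i$ defined for $g\in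 C^\infty(\mathbb R^n)$ such that $g$ and its partial derivatives have at most polynomial growth, and let $L^{-1}F=-\sum_{p\ge 1}\frac1p J_pF$. Define the Gamma operators by $\Gamma_0(F)=F$ and $\Gamma_{i+1}(F)=\langle D\Gamma_i(F),-DL^{-1}F\rangle_{\mathfrak H}$ for $i\ge 0$. Let $\nu>0$, $f\in\mathfrak H^{\odot 2}$, and let $F=I_2(f)$ satisfy $\mathbb E[F^2]=2\nu$. Then $L^{-1}F\in\mathbb D^{1,2}$ and all $\Gamma_i(F)$, $i\ge 0$, are well-defined elements of $L^2(\Omega)$ lying in $\mathbb D^{1,2}$, and for every integer $r\ge 1$ $$\operatorname{Var}\big(\Gamma_{r+1}(F)-2\Gamma_r(F)\big)\le 4\nu\,\operatorname{Var}\big(\Gamma_r(F)-2\Gamma_{r-1}(F)\big).$$ In particular $\operatorname{Var}(\Gamma_2(F)-2\Gamma_1(F))\le 4\nu\,\operatorname{Var}(\Gamma_1(F)-2F)$. Moreover, for every integer $r\ge 1$, $$\operatorname{Var}\big(\Gamma_{r+1}(F)-2\Gamma_r(F)\big)\le (4\nu)^r\,\operatorname{Var}\big(\Gamma_1(F)-2F\big).$$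 -/

import Mathlib

open MeasureTheory ProbabilityTheory
open scoped TensorProduct InnerProductSpace

noncomputable section

namespace WienerChaos

variable {H : Type*} [NormedAddCommGroup H] [InnerProductSpace ℝ H]
variable {Ω : Type*} [MeasurableSpace Ω]

/-- `X` is an isonormal Gaussian process over the Hilbert space `H`: a centered jointly Gaussian
family indexed by `H` with covariance `E[X(g) X(h)] = ⟪g, h⟫`. -/
structure IsIsonormal (X : H → Ω → ℝ) (P : Measure Ω) : Prop where
  gaussian : IsGaussianProcess X P
  centered : ∀ h, ∫ ω, X h ω ∂P = 0
  covariance : ∀ g h, ∫ ω, X g ω * X h ω ∂P = ⟪g, h⟫_ℝ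

/-- The `q`-th Wiener chaos: the closed linear subspace of `L²(Ω)` generated by the random
variables `H_q(X(h))`, `‖h‖ = 1`, where `H_q` is the `q`-th (probabilists') Hermite polynomial. -/
def chaos (X : H → Ω → ℝ) (P : Measure Ω) (q : ℕ) : Submodule ℝ (Lp ℝ 2 P) :=
  (Submodule.span ℝ {F : Lp ℝ 2 P | ∃ h : H, ‖h‖ = 1 ∧
    F =ᵐ[P] fun ω => Polynomial.aeval (X h ω) (Polynomial.hermite q)}).topologicalClosure

instance (X : H → Ω → ℝ) (P : Measure Ω) (q : ℕ) : CompleteSpace (chaos X P q) :=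
  (Submodule.isClosed_topologicalClosure _).completeSpace_coe

/-- The pseudo-inverse `L⁻¹ F = - ∑_{p ≥ 1} (1/p) J_p F` of the Ornstein-Uhlenbeck generator, where
`J_p F = I_p(f_p)`, the `p`-th term of the chaos expansion of `F`, is the orthogonal projection of
`F` on the `p`-th chaos. -/
def pseudoInverseL (X : H → Ω → ℝ) (P : Measure Ω) (F : Lp ℝ 2 P) : Lp ℝ 2 P :=
  - ∑' p : ℕ, ((1 : ℝ) / ((p : ℝ) + 1)) • (chaos X P (p + 1)).starProjection F

/-- The pairs `(F, DF)` with `F = g(X(φ₁), …, X(φₙ))` a smooth random variable (`g` smooth, with all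
derivatives of polynomial growth) and `DF = ∑ i, ∂ᵢg(X(φ₁), …, X(φₙ)) φᵢ`. -/
def smoothPairs (X : H → Ω → ℝ) (P : Measure Ω) : Set (Lp ℝ 2 P × Lp H 2 P) :=
  {p | ∃ (n : ℕ) (φ : Fin n → H) (g : (Fin n → ℝ) → ℝ), g.HasTemperateGrowth ∧
    (p.1 =ᵐ[P] fun ω => g (fun i => X (φ i) ω)) ∧
    (p.2 =ᵐ[P] fun ω => ∑ i, fderiv ℝ g (fun j => X (φ j) ω) (Pi.single i 1) • φ i)}

/-- The Malliavin derivative as a partially defined operator `L²(Ω) → L²(Ω; H)`: the closure of its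
restriction to the smooth random variables. Its domain is the space `𝔻^{1,2}`. -/
def malliavinD (X : H → Ω → ℝ) (P : Measure Ω) : Lp ℝ 2 P →ₗ.[ℝ] Lp H 2 P :=
  (Submodule.span ℝ (smoothPairs X P)).topologicalClosure.toLinearPMap

open Classical in
/-- `DF`, extended by `0` to `F ∉ 𝔻^{1,2}`. -/
def malliavinDeriv (X : H → Ω → ℝ) (P : Measure Ω) (F : Lp ℝ 2 P) : Lp H 2 P :=
  if h : F ∈ (malliavinD X P).domain then malliavinD X P ⟨F, h⟩ else 0

/-- The random variable `⟪DG, -D L⁻¹ F⟫`. -/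
def gammaStep (X : H → Ω → ℝ) (P : Measure Ω) (F G : Lp ℝ 2 P) : Ω → ℝ :=
  fun ω => ⟪malliavinDeriv X P G ω, - malliavinDeriv X P (pseudoInverseL X P F) ω⟫_ℝ

open Classical in
/-- The iterated Gamma operators `Γ₀(F) = F`, `Γ_{i+1}(F) = ⟪D Γ_i(F), -D L⁻¹ F⟫`, as elements of
`L²(Ω)` (with value `0` if the right-hand side is not square integrable). -/
def Gam (X : H → Ω → ℝ) (P : Measure Ω) (F : Lp ℝ 2 P) : ℕ → Lp ℝ 2 P
  | 0 => F
  | i + 1 => if h : MemLp (gammaStep X P F (Gam X P F i)) 2 P then h.toLp _ else 0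

/-- All steps of the recursion for `Γ_i(F)` are meaningful: `L⁻¹ F` and every `Γ_i(F)` lie in
`𝔻^{1,2}`, and every `⟪D Γ_i(F), -D L⁻¹ F⟫` is square integrable. -/
def GamWellDefined (X : H → Ω → ℝ) (P : Measure Ω) (F : Lp ℝ 2 P) : Prop :=
  pseudoInverseL X P F ∈ (malliavinD X P).domain ∧
    ∀ i, Gam X P F i ∈ (malliavinD X P).domain ∧ MemLp (gammaStep X P F (Gam X P F i)) 2 P

variable (H) in
/-- The Hilbert space tensor product `H^{⊗2}`. -/
abbrev Tensor2 : Type _ := UniformSpace.Completion (H ⊗[ℝ] H)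

variable (H) in
/-- The symmetric tensor product `H^{⊙2}`: the closed linear span of the tensors `h ⊗ h`. -/
def symTensor2 : Submodule ℝ (Tensor2 H) :=
  (Submodule.span ℝ (Set.range fun h : H => ((h ⊗ₜ[ℝ] h : H ⊗[ℝ] H) : Tensor2 H))).topologicalClosure

/-- `F = I₂(f)`: the double Wiener-Itô integral is the continuous linear map from `H^{⊙2}` to `L²(Ω)`
with `I₂(h ⊗ h) = H₂(X(h))` for every unit vector `h`; here it is given by its graph, the closed
linear span of the pairs `(h ⊗ h, H₂(X(h)))`. -/
def IsI2 (X : H → Ω → ℝ) (P : Measure Ω) (f : symTensor2 H) (F : Lp ℝ 2 P) : Prop :=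
  ((f : Tensor2 H), F) ∈ (Submodule.span ℝ {p : Tensor2 H × Lp ℝ 2 P | ∃ h : H, ‖h‖ = 1 ∧
    p.1 = ((h ⊗ₜ[ℝ] h : H ⊗[ℝ] H) : Tensor2 H) ∧
    p.2 =ᵐ[P] fun ω => Polynomial.aeval (X h ω) (Polynomial.hermite 2)}).topologicalClosure

end WienerChaos

end

/-!
A tensor `f` in `H^{⊗2}` is a Hilbert-Schmidt operator, and the contraction
`(a ⊗ b, c ⊗ d) ↦ ⟪b, d⟫ a ⊗ c` is `(S, T) ↦ S Tᵀ`. The theorem reduces to the submultiplicativity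
of the Hilbert-Schmidt norm under this product (`norm_contract_le`); no spectral decomposition of
`f` is used.

Write `I₂ : H^{⊗2} → L²(Ω)` for the extension of `a ⊗ b ↦ X(a) X(b) - ⟪a, b⟫` (`doubleIntegral`)
and `Φ : H^{⊗2} → L²(Ω; H)` for the extension of `a ⊗ b ↦ X(a) b` (`partialIntegral`). Three facts
determine the Gamma operators of `F = I₂(f)`, `f` symmetric:

* `D I₂(t) = 2 Φ(t)` for symmetric `t` (`malliavinDeriv_doubleIntegral_add_const`);
* `L⁻¹ F = - F / 2`, because the second chaos is orthogonal to the others (`pseudoInverseL_eq`);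
* `⟪Φ(s), Φ(t)⟫ = I₂(s tᵀ) + ⟪s, t⟫` (`inner_partialIntegral_ae`), which for elementary tensors is
  an identity between products of two Gaussian variables and extends by continuity in `L¹(Ω)`.

It follows by induction that `Γ_r(F) = 2^r I₂(f^{r+1}) + c_r` with operator powers of `f`
(`exists_gam_eq`). Since `Var I₂(t) = 2 ‖t‖²` for symmetric `t`,
`Var(Γ_{r+1}(F) - 2 Γ_r(F)) = 2 · 4^{r+1} ‖f^{r+2} - f^{r+1}‖²` (`variance_gam_sub`), and each
difference `f^{r+2} - f^{r+1}` is the previous one times `f`, where `‖f‖² = ν`.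

That `D` is a well-defined operator rests on the integration by parts formula
`E[X(h) g(X(φ))] = ∑ i, ⟪φ i, h⟫ E[∂ᵢ g(X(φ))]` (`IsIsonormal.integral_mul_eq`), which gives the
closability of the derivative (`IsIsonormal.closable`) as well as the fourth moments and the
orthogonality of the chaoses.
-/

noncomputable section

namespace WienerChaos

variable {H : Type*} [NormedAddCommGroup H] [InnerProductSpace ℝ H]
variable {Ω : Type*} [MeasurableSpace Ω] {P : Measure Ω} {X : H → Ω → ℝ}

/-! ### Gaussian integration by parts -/

/-- Stein's identity in dimension one: integration by parts against the Gaussian density, whose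
derivative is `-x` times the density. -/
lemma integral_id_mul_gaussianReal_eq {u u' : ℝ → ℝ} (hu : ∀ x, HasDerivAt u (u' x) x)
    (h0 : Integrable u (gaussianReal 0 1)) (h1 : Integrable (fun x => x * u x) (gaussianReal 0 1))
    (h2 : Integrable u' (gaussianReal 0 1)) :
    ∫ x, x * u x ∂(gaussianReal 0 1) = ∫ x, u' x ∂(gaussianReal 0 1) := by
  -- integrability against the Gaussian measure, in terms of Lebesgue measure
  have key : ∀ w : ℝ → ℝ, Integrable w (gaussianReal 0 1) →
      Integrable (fun x => w x * gaussianPDFReal 0 1 x) := by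
    intro w hw
    rw [gaussianReal_of_var_ne_zero _ one_ne_zero] at hw
    have := (integrable_withDensity_iff (measurable_gaussianPDF 0 1)
      (Filter.Eventually.of_forall fun x => gaussianPDF_lt_top)).1 hw
    simpa only [toReal_gaussianPDF] using this
  have hpdf : ∀ x, HasDerivAt (gaussianPDFReal 0 1) (-x * gaussianPDFReal 0 1 x) x := by
    intro x
    have h : HasDerivAt (fun x : ℝ => -x ^ 2 / 2) (-x) x :=
      ((hasDerivAt_pow 2 x).neg.div_const 2).congr_deriv (by simp; ring)
    have e : gaussianPDFReal 0 1 = fun x => (√(2 * Real.pi))⁻¹ * Real.exp (-x ^ 2 / 2) := by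
      ext x; simp [gaussianPDFReal]
    rw [e]
    exact (h.exp.const_mul _).congr_deriv (by ring)
  have ibp := integral_mul_deriv_eq_deriv_mul_of_integrable (u := u) (u' := u')
    (v := gaussianPDFReal 0 1) (v' := fun x => -x * gaussianPDFReal 0 1 x)
    (fun x _ => hu x) (fun x _ => hpdf x)
    (by
      refine (key _ h1).neg.congr (Filter.Eventually.of_forall fun x => ?_)
      simp; ring)
    (key _ h2) (key _ h0)
  rw [integral_gaussianReal_eq_integral_smul one_ne_zero,
    integral_gaussianReal_eq_integral_smul one_ne_zero]
  simp only [smul_eq_mul]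
  calc ∫ x, gaussianPDFReal 0 1 x * (x * u x)
      = - ∫ x, u x * (-x * gaussianPDFReal 0 1 x) := by
        rw [← integral_neg]; congr 1; ext x; ring
    _ = ∫ x, gaussianPDFReal 0 1 x * u' x := by
        rw [ibp, neg_neg]; congr 1; ext x; ring

lemma _root_.Function.HasTemperateGrowth.fderiv_apply {E : Type*} [NormedAddCommGroup E]
    [NormedSpace ℝ E] {g : E → ℝ} (hg : g.HasTemperateGrowth) (v : E) :
    (fun x => fderiv ℝ g x v).HasTemperateGrowth := by
  have h : (fderiv ℝ g).HasTemperateGrowth := by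
    refine ⟨hg.1.fderiv_right (m := (⊤ : ℕ∞)) (by simp), fun n => ?_⟩
    obtain ⟨k, C, hC⟩ := hg.2 (n + 1)
    exact ⟨k, C, fun x => by simpa [norm_iteratedFDeriv_fderiv] using hC x⟩
  exact (ContinuousLinearMap.apply ℝ ℝ v).hasTemperateGrowth.comp h

namespace IsIsonormal

lemma memLp (hX : IsIsonormal X P) (h : H) : MemLp (X h) 2 P :=
  (hX.gaussian.hasGaussianLaw_eval h).memLp (by simp)

/-- The isometric embedding `h ↦ X(h)` of `H` into `L²(Ω)`. -/
def toLpₗᵢ (hX : IsIsonormal X P) : H →ₗᵢ[ℝ] Lp ℝ 2 P := by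
  have inn : ∀ g h, ⟪(hX.memLp g).toLp, (hX.memLp h).toLp⟫_ℝ = ⟪g, h⟫_ℝ := by
    intro g h
    rw [L2.inner_def, ← hX.covariance g h]
    refine integral_congr_ae ?_
    filter_upwards [(hX.memLp g).coeFn_toLp, (hX.memLp h).coeFn_toLp] with ω h1 h2
    simp [h1, h2, mul_comm]
  exact
  { toFun := fun h => (hX.memLp h).toLp
    map_add' := fun g h => by
      rw [← sub_eq_zero, ← inner_self_eq_zero (𝕜 := ℝ)]
      simp only [inner_sub_left, inner_sub_right, inner_add_left, inner_add_right, inn]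
      ring
    map_smul' := fun c h => by
      rw [← sub_eq_zero, ← inner_self_eq_zero (𝕜 := ℝ)]
      simp only [inner_sub_left, inner_sub_right, inner_smul_left, inner_smul_right, inn,
        RingHom.id_apply, RCLike.conj_to_real]
      ring
    norm_map' := fun h => by
      change ‖(hX.memLp h).toLp‖ = ‖h‖
      rw [← sq_eq_sq₀ (norm_nonneg _) (norm_nonneg _), ← real_inner_self_eq_norm_sq,
        ← real_inner_self_eq_norm_sq, inn] }

lemma coeFn_toLpₗᵢ (hX : IsIsonormal X P) (h : H) : hX.toLpₗᵢ h =ᵐ[P] X h :=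
  (hX.memLp h).coeFn_toLp

lemma ae_add (hX : IsIsonormal X P) (g h : H) : X (g + h) =ᵐ[P] fun ω => X g ω + X h ω := by
  have e := Lp.coeFn_add (hX.toLpₗᵢ g) (hX.toLpₗᵢ h)
  rw [← map_add] at e
  filter_upwards [e, hX.coeFn_toLpₗᵢ g, hX.coeFn_toLpₗᵢ h, hX.coeFn_toLpₗᵢ (g + h)]
    with ω h1 h2 h3 h4
  rw [← h4, h1, Pi.add_apply, h2, h3]

lemma ae_smul (hX : IsIsonormal X P) (c : ℝ) (h : H) : X (c • h) =ᵐ[P] fun ω => c * X h ω := by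
  have e := Lp.coeFn_smul c (hX.toLpₗᵢ h)
  rw [← map_smul] at e
  filter_upwards [e, hX.coeFn_toLpₗᵢ h, hX.coeFn_toLpₗᵢ (c • h)] with ω h1 h2 h4
  rw [← h4, h1, Pi.smul_apply, h2, smul_eq_mul]

lemma hasGaussianLaw_pi (hX : IsIsonormal X P) {ι : Type*} [Fintype ι] (φ : ι → H) :
    HasGaussianLaw (fun ω i => X (φ i) ω) P := by
  classical
  have h := (hX.gaussian.comp_right φ).hasGaussianLaw Finset.univ
  exact h.map (ContinuousLinearMap.pi fun i =>
    ContinuousLinearMap.proj (⟨i, Finset.mem_univ i⟩ : {x // x ∈ (Finset.univ : Finset ι)}))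

lemma _root_.MeasureTheory.MemLp.one_add_norm_pow {E : Type*} [NormedAddCommGroup E]
    [IsFiniteMeasure P] {Y : Ω → E} (hY : ∀ q : ENNReal, q ≠ ⊤ → MemLp Y q P) (k : ℕ)
    {p : ENNReal} (hp : p ≠ ⊤) : MemLp (fun ω => (1 + ‖Y ω‖) ^ k) p P := by
  rcases Nat.eq_zero_or_pos k with rfl | hk
  · simpa using memLp_const (1 : ℝ)
  · have hq : p * k ≠ ⊤ := ENNReal.mul_ne_top hp (by simp)
    have h1 : MemLp (fun ω => 1 + ‖Y ω‖) (p * k) P := (memLp_const (1 : ℝ)).add (hY _ hq).norm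
    have h3 := h1.norm_rpow_div (k : ENNReal)
    have hk' : (k : ENNReal) ≠ 0 := by exact_mod_cast hk.ne'
    rw [ENNReal.mul_div_cancel_right hk' (by simp)] at h3
    refine h3.ae_eq (Filter.Eventually.of_forall fun ω => ?_)
    have : 0 ≤ 1 + ‖Y ω‖ := by positivity
    simp [abs_of_nonneg this]

lemma memLp_of_bound (hX : IsIsonormal X P) {ι : Type*} [Fintype ι] (φ : ι → H)
    {g : (ι → ℝ) → ℝ} (hg : Continuous g) {C : ℝ} {k : ℕ}
    (hb : ∀ x, ‖g x‖ ≤ C * (1 + ‖x‖) ^ k) {p : ENNReal} (hp : p ≠ ⊤) :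
    MemLp (fun ω => g (fun i => X (φ i) ω)) p P := by
  have : IsProbabilityMeasure P := hX.gaussian.isProbabilityMeasure
  have hm : AEMeasurable (fun ω i => X (φ i) ω) P :=
    aemeasurable_pi_lambda _ fun i => hX.gaussian.aemeasurable (φ i)
  have h2 := MemLp.one_add_norm_pow (fun q hq => (hX.hasGaussianLaw_pi φ).memLp hq) k hp
  have h3 : AEStronglyMeasurable (fun ω => g (fun i => X (φ i) ω)) P :=
    (hg.measurable.comp_aemeasurable hm).aestronglyMeasurable
  refine MemLp.of_le (h2.const_mul C) h3 (Filter.Eventually.of_forall fun ω => ?_)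
  exact (hb _).trans (le_abs_self _)

lemma memLp_of_hasTemperateGrowth (hX : IsIsonormal X P) {ι : Type*} [Fintype ι] (φ : ι → H)
    {g : (ι → ℝ) → ℝ} (hg : g.HasTemperateGrowth) {p : ENNReal} (hp : p ≠ ⊤) :
    MemLp (fun ω => g (fun i => X (φ i) ω)) p P := by
  obtain ⟨k, C, h⟩ := hg.2 0
  exact hX.memLp_of_bound φ hg.1.continuous (by simpa using h) hp

end IsIsonormal

namespace IsIsonormal

lemma integrable_mul_of_hasTemperateGrowth (hX : IsIsonormal X P) {ι : Type*} [Fintype ι]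
    (h : H) (φ : ι → H) {g : (ι → ℝ) → ℝ} (hg : g.HasTemperateGrowth) :
    Integrable (fun ω => X h ω * g (fun i => X (φ i) ω)) P :=
  (hX.memLp h).integrable_mul (hX.memLp_of_hasTemperateGrowth φ hg (p := 2) (by simp))

lemma map_eq_gaussianReal (hX : IsIsonormal X P) {h : H} (hh : ‖h‖ = 1) :
    P.map (X h) = gaussianReal 0 1 := by
  have := hX.gaussian.isProbabilityMeasure
  have hv : Var[X h; P] = 1 := by
    rw [variance_of_integral_eq_zero (hX.gaussian.aemeasurable h) (hX.centered h)]
    have := hX.covariance h h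
    rw [real_inner_self_eq_norm_sq, hh] at this
    simpa [pow_two] using this
  rw [(hX.gaussian.hasGaussianLaw_eval h).map_eq_gaussianReal, hX.centered, hv]
  simp

/-- `X(h)` is independent of every family `(X(ψ i))` with `ψ i ⟂ h`. -/
lemma indepFun_of_inner_eq_zero (hX : IsIsonormal X P) {ι : Type*} {h : H} {ψ : ι → H}
    (hψ : ∀ i, ⟪h, ψ i⟫_ℝ = 0) : X h ⟂ᵢ[P] fun ω i => X (ψ i) ω := by
  have := hX.gaussian.isProbabilityMeasure
  have hp : IsGaussianProcess (Sum.elim (fun _ : Unit => X h) fun i => X (ψ i)) P := by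
    have e : Sum.elim (fun _ : Unit => X h) (fun i => X (ψ i)) =
        X ∘ Sum.elim (fun _ : Unit => h) ψ := by
      ext s; cases s <;> rfl
    rw [e]
    exact hX.gaussian.comp_right _
  have := hp.indepFun_of_covariance_eq_zero (fun _ => hX.gaussian.aemeasurable _)
    (fun i => hX.gaussian.aemeasurable _) (fun _ i => by
      rw [covariance_eq_sub (hX.memLp h) (hX.memLp (ψ i)), hX.centered, zero_mul, sub_zero]
      exact (hX.covariance h (ψ i)).trans (hψ i))
  exact this.comp (φ := fun x : Unit → ℝ => x ()) (measurable_pi_apply _) measurable_id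

/-- Integration by parts in a unit direction. The vector `(X(φ i))` splits into `X(h) • ρ`, with
`ρ i = ⟪φ i, h⟫`, and a part independent of `X(h)`; conditionally on the latter the identity is
Stein's identity in the variable `X(h)`. -/
lemma integral_mul_eq_of_norm_eq_one (hX : IsIsonormal X P) {ι : Type*} [Fintype ι] {h : H}
    (hh : ‖h‖ = 1) (φ : ι → H) {g : (ι → ℝ) → ℝ} (hg : g.HasTemperateGrowth) :
    ∫ ω, X h ω * g (fun i => X (φ i) ω) ∂P =
      ∫ ω, fderiv ℝ g (fun i => X (φ i) ω) (fun i => ⟪φ i, h⟫_ℝ) ∂P := by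
  have := hX.gaussian.isProbabilityMeasure
  set ρ : ι → ℝ := fun i => ⟪φ i, h⟫_ℝ with hρ
  let ψ : ι → H := fun i => φ i - ρ i • h
  let Y : Ω → ι → ℝ := fun ω i => X (ψ i) ω
  have hYm : AEMeasurable Y P := aemeasurable_pi_lambda _ fun i => hX.gaussian.aemeasurable (ψ i)
  have hind : X h ⟂ᵢ[P] Y := hX.indepFun_of_inner_eq_zero fun i => by
    simp [ψ, ρ, inner_sub_right, inner_smul_right, hh, real_inner_comm]
  have hmap := (indepFun_iff_map_prod_eq_prod_map_map (hX.gaussian.aemeasurable h) hYm).1 hind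
  rw [hX.map_eq_gaussianReal hh] at hmap
  have hm : AEMeasurable (fun ω => (X h ω, Y ω)) P := (hX.gaussian.aemeasurable h).prodMk hYm
  have hsplit : ∀ᵐ ω ∂P, (fun i => X (φ i) ω) = X h ω • ρ + Y ω := by
    have : ∀ i, ∀ᵐ ω ∂P, X (φ i) ω = X h ω * ρ i + Y ω i := by
      intro i
      filter_upwards [hX.ae_add (ψ i) (ρ i • h), hX.ae_smul (ρ i) h] with ω h1 h2
      simp only [ψ, sub_add_cancel] at h1
      rw [h1, h2]; simp only [Y, ψ]; ring
    filter_upwards [ae_all_iff.2 this] with ω hω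
    ext i; simpa using hω i
  have hd := hg.fderiv_apply ρ
  -- all integrals below are transported to the product measure
  have transport : ∀ G : ℝ × (ι → ℝ) → ℝ, Continuous G →
      (Integrable (fun ω => G (X h ω, Y ω)) P →
        Integrable G ((gaussianReal 0 1).prod (P.map Y))) ∧
      ∫ ω, G (X h ω, Y ω) ∂P = ∫ z, G z ∂((gaussianReal 0 1).prod (P.map Y)) := by
    intro G hG
    rw [← hmap]
    exact ⟨fun hi => (integrable_map_measure hG.aestronglyMeasurable hm).2 hi,
      (integral_map hm hG.aestronglyMeasurable).symm⟩
  have hcg := hg.1.continuous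
  have hcd := hd.1.continuous
  have e0 : (fun ω => g (fun i => X (φ i) ω)) =ᵐ[P] fun ω => g (X h ω • ρ + Y ω) := by
    filter_upwards [hsplit] with ω hω; rw [hω]
  have e1 : (fun ω => X h ω * g (fun i => X (φ i) ω)) =ᵐ[P]
      fun ω => X h ω * g (X h ω • ρ + Y ω) := by
    filter_upwards [hsplit] with ω hω; rw [hω]
  have e2 : (fun ω => fderiv ℝ g (fun i => X (φ i) ω) ρ) =ᵐ[P]
      fun ω => fderiv ℝ g (X h ω • ρ + Y ω) ρ := by
    filter_upwards [hsplit] with ω hω; rw [hω]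
  have t0 := (transport (fun z => g (z.1 • ρ + z.2)) (by fun_prop)).1
    (((hX.memLp_of_hasTemperateGrowth φ hg (p := 1) (by simp)).integrable le_rfl).congr e0)
  have t1 := transport (fun z => z.1 * g (z.1 • ρ + z.2)) (by fun_prop)
  have i1 := t1.1 ((hX.integrable_mul_of_hasTemperateGrowth h φ hg).congr e1)
  have t2 := transport (fun z => fderiv ℝ g (z.1 • ρ + z.2) ρ)
    (hcd.comp (by fun_prop : Continuous fun z : ℝ × (ι → ℝ) => z.1 • ρ + z.2))
  have i2 := t2.1
    (((hX.memLp_of_hasTemperateGrowth φ hd (p := 1) (by simp)).integrable le_rfl).congr e2)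
  have : IsProbabilityMeasure (P.map Y) := Measure.isProbabilityMeasure_map hYm
  rw [integral_congr_ae e1, integral_congr_ae e2, t1.2, t2.2, integral_prod_symm _ i1,
    integral_prod_symm _ i2]
  refine integral_congr_ae ?_
  filter_upwards [t0.prod_left_ae, i1.prod_left_ae, i2.prod_left_ae] with y h0 h1 h2
  refine integral_id_mul_gaussianReal_eq (fun x => ?_) h0 h1 h2
  have hl : HasDerivAt (fun x : ℝ => x • ρ + y) ρ x := by
    simpa using ((hasDerivAt_id x).smul_const ρ).add_const y
  exact ((hg.1.differentiable (by simp)) _).hasFDerivAt.comp_hasDerivAt x hl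

/-- Gaussian integration by parts. The sum `∑ i, ⟪φ i, h⟫ ∂ᵢ g` is written as the derivative of `g`
in the direction `(⟪φ i, h⟫)`. -/
lemma integral_mul_eq (hX : IsIsonormal X P) {ι : Type*} [Fintype ι] (h : H)
    (φ : ι → H) {g : (ι → ℝ) → ℝ} (hg : g.HasTemperateGrowth) :
    ∫ ω, X h ω * g (fun i => X (φ i) ω) ∂P =
      ∫ ω, fderiv ℝ g (fun i => X (φ i) ω) (fun i => ⟪φ i, h⟫_ℝ) ∂P := by
  rcases eq_or_ne h 0 with rfl | hh
  · have e : X 0 =ᵐ[P] fun _ => 0 := by simpa using hX.ae_smul 0 (0 : H)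
    have : (fun ω => X 0 ω * g (fun i => X (φ i) ω)) =ᵐ[P] fun _ => 0 := by
      filter_upwards [e] with ω hω; simp [hω]
    rw [integral_congr_ae this]
    have z : (fun i => ⟪φ i, (0 : H)⟫_ℝ) = 0 := by ext; simp
    rw [z]
    simp
  · have hn : ‖h‖ ≠ 0 := norm_ne_zero_iff.2 hh
    have hu : ‖‖h‖⁻¹ • h‖ = 1 := by simp [norm_smul, hn]
    have key := hX.integral_mul_eq_of_norm_eq_one hu φ hg
    have e : X h =ᵐ[P] fun ω => ‖h‖ * X (‖h‖⁻¹ • h) ω := by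
      simpa [smul_smul, hn] using hX.ae_smul ‖h‖ (‖h‖⁻¹ • h)
    have e1 : (fun ω => X h ω * g (fun i => X (φ i) ω)) =ᵐ[P]
        fun ω => ‖h‖ * (X (‖h‖⁻¹ • h) ω * g (fun i => X (φ i) ω)) := by
      filter_upwards [e] with ω hω; rw [hω, mul_assoc]
    have e2 : (fun i => ⟪φ i, h⟫_ℝ) = ‖h‖ • fun i => ⟪φ i, ‖h‖⁻¹ • h⟫_ℝ := by
      ext i; simp [inner_smul_right, hn]
    rw [integral_congr_ae e1, integral_const_mul, key, e2]
    simp only [map_smul, smul_eq_mul]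
    rw [integral_const_mul]

end IsIsonormal

/-! ### Closability of the Malliavin derivative -/

lemma map_mem_of_mem_closure_span {E F : Type*} [NormedAddCommGroup E] [NormedSpace ℝ E]
    [NormedAddCommGroup F] [NormedSpace ℝ F] (L : E →L[ℝ] F) {S : Set E} {M : Submodule ℝ F}
    (hM : IsClosed (M : Set F)) (h : ∀ x ∈ S, L x ∈ M) {x : E}
    (hx : x ∈ (Submodule.span ℝ S).topologicalClosure) : L x ∈ M :=
  Submodule.topologicalClosure_minimal (t := M.comap (L : E →ₗ[ℝ] F)) _
    (Submodule.span_le.2 h) (hM.preimage L.continuous) hx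

lemma map_eq_of_mem_closure_span {E F : Type*} [NormedAddCommGroup E] [NormedSpace ℝ E]
    [NormedAddCommGroup F] [NormedSpace ℝ F] (L L' : E →L[ℝ] F) {S : Set E}
    (h : ∀ x ∈ S, L x = L' x) {x : E}
    (hx : x ∈ (Submodule.span ℝ S).topologicalClosure) : L x = L' x := by
  have := map_mem_of_mem_closure_span (L - L') (M := ⊥) (by simp)
    (fun y hy => by simp [h y hy]) hx
  simpa [sub_eq_zero] using this

lemma coeFn_sum_ae {E : Type*} [NormedAddCommGroup E] {p : ENNReal} {ι : Type*} (s : Finset ι)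
    (f : ι → Lp E p P) : ((∑ i ∈ s, f i : Lp E p P) : Ω → E) =ᵐ[P] fun ω => ∑ i ∈ s, f i ω := by
  classical
  induction s using Finset.induction_on with
  | empty =>
    simp only [Finset.sum_empty]
    exact Lp.coeFn_zero E p P
  | insert a s ha ih =>
    rw [Finset.sum_insert ha]
    filter_upwards [Lp.coeFn_add (f a) (∑ i ∈ s, f i), ih] with ω h1 h2
    rw [h1, Pi.add_apply, h2, Finset.sum_insert ha]

lemma hasTemperateGrowth_eval {ι : Type*} [Fintype ι] (i : ι) :
    (fun x : ι → ℝ => x i).HasTemperateGrowth :=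
  (ContinuousLinearMap.proj (R := ℝ) (φ := fun _ : ι => ℝ) i).hasTemperateGrowth

lemma hasTemperateGrowth_comp_right {ι κ : Type*} [Fintype ι] [Fintype κ] (e : κ → ι)
    {g : (κ → ℝ) → ℝ} (hg : g.HasTemperateGrowth) :
    (fun x : ι → ℝ => g fun k => x (e k)).HasTemperateGrowth :=
  hg.comp (ContinuousLinearMap.pi fun k =>
    ContinuousLinearMap.proj (R := ℝ) (φ := fun _ : ι => ℝ) (e k)).hasTemperateGrowth

lemma fderiv_comp_right {ι κ : Type*} [Fintype ι] [Fintype κ] (e : κ → ι)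
    {g : (κ → ℝ) → ℝ} (hg : Differentiable ℝ g) (x v : ι → ℝ) :
    fderiv ℝ (fun x : ι → ℝ => g fun k => x (e k)) x v =
      fderiv ℝ g (fun k => x (e k)) fun k => v (e k) := by
  have := (hg (fun k => x (e k))).hasFDerivAt.comp x (ContinuousLinearMap.pi fun k =>
    ContinuousLinearMap.proj (R := ℝ) (φ := fun _ : ι => ℝ) (e k)).hasFDerivAt
  exact congrArg (· v) this.fderiv

namespace IsIsonormal

/-- The integration by parts formula for a product of two smooth random variables. -/
lemma integral_fderiv_mul_eq (hX : IsIsonormal X P) {ι κ : Type*} [Fintype ι] [Fintype κ]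
    (h : H) (φ : ι → H) (ψ : κ → H) {g : (ι → ℝ) → ℝ} {k : (κ → ℝ) → ℝ}
    (hg : g.HasTemperateGrowth) (hk : k.HasTemperateGrowth) :
    ∫ ω, fderiv ℝ g (fun i => X (φ i) ω) (fun i => ⟪φ i, h⟫_ℝ) * k (fun j => X (ψ j) ω) ∂P =
      ∫ ω, g (fun i => X (φ i) ω) * (X h ω * k (fun j => X (ψ j) ω) -
        fderiv ℝ k (fun j => X (ψ j) ω) fun j => ⟪ψ j, h⟫_ℝ) ∂P := by
  have hG := (hasTemperateGrowth_comp_right (Sum.inl (β := κ)) hg).mul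
    (hasTemperateGrowth_comp_right (Sum.inr (α := ι)) hk)
  have key := hX.integral_mul_eq h (Sum.elim φ ψ) hG
  have hgd := hg.1.differentiable (by simp)
  have hkd := hk.1.differentiable (by simp)
  have hfd : ∀ x v : ι ⊕ κ → ℝ, fderiv ℝ ((fun x : ι ⊕ κ → ℝ => g fun i => x (Sum.inl i)) *
      fun x : ι ⊕ κ → ℝ => k fun j => x (Sum.inr j)) x v =
      fderiv ℝ g (fun i => x (Sum.inl i)) (fun i => v (Sum.inl i)) * k (fun j => x (Sum.inr j)) +
      g (fun i => x (Sum.inl i)) * fderiv ℝ k (fun j => x (Sum.inr j)) fun j => v (Sum.inr j) := by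
    intro x v
    rw [fderiv_mul ((hasTemperateGrowth_comp_right _ hg).1.differentiable (by simp) x)
      ((hasTemperateGrowth_comp_right _ hk).1.differentiable (by simp) x)]
    simp only [_root_.add_apply, _root_.smul_apply, smul_eq_mul]
    rw [fderiv_comp_right _ hgd, fderiv_comp_right _ hkd]
    ring
  simp only [hfd, Pi.mul_apply, Sum.elim_inl, Sum.elim_inr] at key
  have m1 := hX.memLp_of_hasTemperateGrowth φ hg (p := 2) (by simp)
  have m2 := hX.memLp_of_hasTemperateGrowth ψ hk (p := 2) (by simp)
  have m3 := hX.memLp_of_hasTemperateGrowth φ (hg.fderiv_apply fun i => ⟪φ i, h⟫_ℝ)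
    (p := 2) (by simp)
  have m4 := hX.memLp_of_hasTemperateGrowth ψ (hk.fderiv_apply fun i => ⟪ψ i, h⟫_ℝ)
    (p := 2) (by simp)
  have i1 := hX.integrable_mul_of_hasTemperateGrowth h (Sum.elim φ ψ) hG
  simp only [Pi.mul_apply, Sum.elim_inl, Sum.elim_inr] at i1
  have i2 := m1.integrable_mul m4
  have i3 := m3.integrable_mul m2
  have e := integral_add i3 i2
  simp only [Pi.mul_apply] at e
  rw [e] at key
  have e' := integral_sub i1 i2
  rw [key] at e'
  simp only [Pi.mul_apply, add_sub_cancel_right] at e'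
  rw [← e']
  congr 1; ext ω; ring

lemma memLp_mul_sub (hX : IsIsonormal X P) {κ : Type*} [Fintype κ]
    (h : H) (ψ : κ → H) {k : (κ → ℝ) → ℝ} (hk : k.HasTemperateGrowth) :
    MemLp (fun ω => X h ω * k (fun j => X (ψ j) ω) -
        fderiv ℝ k (fun j => X (ψ j) ω) fun j => ⟪ψ j, h⟫_ℝ) 2 P := by
  have h1 : MemLp (fun ω => X h ω * k (fun j => X (ψ j) ω)) 2 P :=
    hX.memLp_of_hasTemperateGrowth (Sum.elim (fun _ : Unit => h) ψ)
      ((hasTemperateGrowth_eval (Sum.inl ())).mul (hasTemperateGrowth_comp_right Sum.inr hk))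
      (by simp)
  exact h1.sub (hX.memLp_of_hasTemperateGrowth ψ (hk.fderiv_apply _) (by simp))

/-- A random vector `K(X(ψ)) • h` lies in the domain of the adjoint of the derivative. -/
lemma exists_divergence (hX : IsIsonormal X P) {κ : Type*} [Fintype κ]
    (h : H) (ψ : κ → H) {k : (κ → ℝ) → ℝ} (hk : k.HasTemperateGrowth) {v : Lp H 2 P}
    (hv : v =ᵐ[P] fun ω => k (fun j => X (ψ j) ω) • h) :
    ∃ W : Lp ℝ 2 P, ∀ p ∈ smoothPairs X P, ⟪v, p.2⟫_ℝ = ⟪W, p.1⟫_ℝ := by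
  refine ⟨(hX.memLp_mul_sub h ψ hk).toLp, ?_⟩
  rintro ⟨F, G⟩ ⟨n, φ, g, hg, hF, hG⟩
  have key := hX.integral_fderiv_mul_eq h φ ψ hg hk
  rw [L2.inner_def, L2.inner_def]
  have e1 : (fun ω => ⟪v ω, G ω⟫_ℝ) =ᵐ[P] fun ω =>
      fderiv ℝ g (fun i => X (φ i) ω) (fun i => ⟪φ i, h⟫_ℝ) * k (fun j => X (ψ j) ω) := by
    filter_upwards [hv, hG] with ω h1 h2
    rw [h1, h2]
    have : (fun i => ⟪φ i, h⟫_ℝ) = ∑ i, ⟪φ i, h⟫_ℝ • (Pi.single i (1 : ℝ) : Fin n → ℝ) := by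
      ext j; simp [Finset.sum_apply, Pi.single_apply]
    rw [this]
    simp only [inner_sum, inner_smul_left, inner_smul_right, map_sum, map_smul, smul_eq_mul,
      Finset.sum_mul, RCLike.conj_to_real, real_inner_comm]
    exact Finset.sum_congr rfl fun i _ => by ring
  rw [integral_congr_ae e1, key]
  refine integral_congr_ae ?_
  filter_upwards [(hX.memLp_mul_sub h ψ hk).coeFn_toLp, hF] with ω h1 h2
  rw [h1, h2]
  simp

/-- If `(0, G)` is a limit of smooth pairs, then `G = 0`. By integration by parts `G` is orthogonal
to every `K(X(ψ)) • h`; being a limit of sums of such vectors, it is orthogonal to itself. -/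
lemma closable (hX : IsIsonormal X P) :
    ∀ p ∈ (Submodule.span ℝ (smoothPairs X P)).topologicalClosure, p.1 = 0 → p.2 = 0 := by
  intro p hp hp1
  let V : Set (Lp H 2 P) := {v | ∃ (n : ℕ) (ψ : Fin n → H) (k : (Fin n → ℝ) → ℝ) (h : H),
    k.HasTemperateGrowth ∧ v =ᵐ[P] fun ω => k (fun j => X (ψ j) ω) • h}
  have orth : ∀ v ∈ V, ⟪v, p.2⟫_ℝ = 0 := by
    rintro v ⟨n, ψ, k, h, hk, hv⟩
    obtain ⟨W, hW⟩ := hX.exists_divergence h ψ hk hv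
    have := map_eq_of_mem_closure_span
      ((innerSL ℝ v).comp (ContinuousLinearMap.snd ℝ (Lp ℝ 2 P) (Lp H 2 P)))
      ((innerSL ℝ W).comp (ContinuousLinearMap.fst ℝ (Lp ℝ 2 P) (Lp H 2 P)))
      (fun q hq => by simpa using hW q hq) hp
    simpa [hp1] using this
  have mem : p.2 ∈ (Submodule.span ℝ V).topologicalClosure := by
    refine map_mem_of_mem_closure_span (ContinuousLinearMap.snd ℝ (Lp ℝ 2 P) (Lp H 2 P))
      (Submodule.isClosed_topologicalClosure _) ?_ hp
    rintro ⟨F, G⟩ ⟨n, φ, g, hg, -, hG⟩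
    refine Submodule.le_topologicalClosure _ ?_
    have hm : ∀ i : Fin n, MemLp (fun ω =>
        fderiv ℝ g (fun j => X (φ j) ω) (Pi.single i 1) • φ i) 2 P := fun i =>
      (ContinuousLinearMap.toSpanSingleton ℝ (φ i)).comp_memLp'
        (hX.memLp_of_hasTemperateGrowth φ (hg.fderiv_apply (Pi.single i 1)) (by simp))
    have : G = ∑ i, (hm i).toLp := by
      refine Lp.ext ?_
      filter_upwards [hG, coeFn_sum_ae Finset.univ fun i => (hm i).toLp,
        ae_all_iff.2 fun i => (hm i).coeFn_toLp] with ω h1 h2 h3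
      rw [h1, h2]
      exact Finset.sum_congr rfl fun i _ => (h3 i).symm
    change G ∈ _
    rw [this]
    exact Submodule.sum_mem _ fun i _ => Submodule.subset_span
      ⟨n, φ, _, φ i, hg.fderiv_apply (Pi.single i 1), (hm i).coeFn_toLp⟩
  have := map_eq_of_mem_closure_span (innerSL ℝ p.2) 0
    (fun v hv => by simpa [real_inner_comm] using orth v hv) mem
  simpa using this

end IsIsonormal

/-- Since the derivative is closable, the closed operator `D` has the closure of the smooth
pairs as its graph. -/
lemma IsIsonormal.malliavinDeriv_eq (hX : IsIsonormal X P) {F : Lp ℝ 2 P} {G : Lp H 2 P}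
    (h : (F, G) ∈ (Submodule.span ℝ (smoothPairs X P)).topologicalClosure) :
    F ∈ (malliavinD X P).domain ∧ malliavinDeriv X P F = G := by
  have hg : (F, G) ∈ (malliavinD X P).graph := by
    rw [malliavinD, Submodule.toLinearPMap_graph_eq _ hX.closable]; exact h
  obtain ⟨⟨F', hF⟩, rfl, hG⟩ := (LinearPMap.mem_graph_iff _).1 hg
  exact ⟨hF, by rw [malliavinDeriv, dif_pos hF]; exact hG⟩

/-! ### Contractions on the Hilbert space tensor product -/

/-- The extension of a continuous linear map from the algebraic tensor product to `H^{⊗2}`. -/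
def extendTensor {E : Type*} [NormedAddCommGroup E] [NormedSpace ℝ E] [CompleteSpace E]
    (L : H ⊗[ℝ] H →L[ℝ] E) : Tensor2 H →L[ℝ] E :=
  L.extend UniformSpace.Completion.toComplL

@[simp]
lemma extendTensor_coe {E : Type*} [NormedAddCommGroup E] [NormedSpace ℝ E] [CompleteSpace E]
    (L : H ⊗[ℝ] H →L[ℝ] E) (t : H ⊗[ℝ] H) : extendTensor L (t : Tensor2 H) = L t :=
  L.extend_eq (e := UniformSpace.Completion.toComplL) UniformSpace.Completion.denseRange_coe
    (UniformSpace.Completion.isUniformInducing_coe _) t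

variable (H) in
/-- The flip `a ⊗ b ↦ b ⊗ a` of `H^{⊗2}`. -/
def swap : Tensor2 H →L[ℝ] Tensor2 H :=
  extendTensor (UniformSpace.Completion.toComplL ∘L
    (TensorProduct.commIsometry ℝ H H).toContinuousLinearEquiv.toContinuousLinearMap)

@[simp]
lemma swap_coe (t : H ⊗[ℝ] H) :
    swap H (t : Tensor2 H) = (TensorProduct.comm ℝ H H t : H ⊗[ℝ] H) := by
  simp [swap]

variable (H) in
/-- The contraction `(a ⊗ b, c ⊗ d) ↦ ⟪b, d⟫ a ⊗ c` on the algebraic tensor product. -/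
def contractAlg : H ⊗[ℝ] H →ₗ[ℝ] H ⊗[ℝ] H →ₗ[ℝ] H ⊗[ℝ] H :=
  (TensorProduct.map₂ (TensorProduct.mk ℝ H H) (innerₗ H)).compr₂
    (TensorProduct.rid ℝ (H ⊗[ℝ] H)).toLinearMap

@[simp]
lemma contractAlg_tmul (a b c d : H) :
    contractAlg H (a ⊗ₜ b) (c ⊗ₜ d) = ⟪b, d⟫_ℝ • (a ⊗ₜ[ℝ] c) := by
  simp [contractAlg, TensorProduct.map₂_apply_tmul]

/-- A tensor can be expanded along every orthonormal basis of any sufficiently large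
finite-dimensional subspace; in particular two tensors have expansions along a common one. -/
lemma exists_expansion (t : H ⊗[ℝ] H) : ∃ E : Submodule ℝ H, FiniteDimensional ℝ E ∧
    ∀ E' : Submodule ℝ H, E ≤ E' → ∀ {n : ℕ} (e : OrthonormalBasis (Fin n) ℝ E'),
      ∃ a : Fin n → H, t = ∑ i, a i ⊗ₜ[ℝ] (e i : H) := by
  induction t using TensorProduct.induction_on with
  | zero => exact ⟨⊥, inferInstance, fun E' _ n e => ⟨0, by simp⟩⟩
  | tmul x y =>
    refine ⟨ℝ ∙ y, inferInstance, fun E' hE n e => ?_⟩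
    let y' : E' := ⟨y, hE (Submodule.mem_span_singleton_self y)⟩
    refine ⟨fun i => ⟪e i, y'⟫_ℝ • x, ?_⟩
    have h : y = ∑ i, ⟪e i, y'⟫_ℝ • (e i : H) := by
      have := congrArg (Subtype.val) (e.sum_repr' y')
      simpa using this.symm
    conv_lhs => rw [h]
    simp [TensorProduct.tmul_sum, TensorProduct.smul_tmul]
  | add s t hs ht =>
    obtain ⟨E₁, f₁, h₁⟩ := hs
    obtain ⟨E₂, f₂, h₂⟩ := ht
    refine ⟨E₁ ⊔ E₂, inferInstance, fun E' hE n e => ?_⟩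
    obtain ⟨a, ha⟩ := h₁ E' (le_sup_left.trans hE) e
    obtain ⟨b, hb⟩ := h₂ E' (le_sup_right.trans hE) e
    exact ⟨a + b, by rw [ha, hb]; simp [TensorProduct.add_tmul, Finset.sum_add_distrib]⟩

/-- Submultiplicativity of the Hilbert-Schmidt norm. If `s = ∑ aᵢ ⊗ eᵢ` and `t = ∑ bᵢ ⊗ eᵢ` with
`e` orthonormal, the contraction is `∑ aᵢ ⊗ bᵢ`, and the bound is the Cauchy-Schwarz inequality. -/
lemma norm_contractAlg_le (s t : H ⊗[ℝ] H) : ‖contractAlg H s t‖ ≤ ‖s‖ * ‖t‖ := by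
  obtain ⟨E₁, f₁, h₁⟩ := exists_expansion s
  obtain ⟨E₂, f₂, h₂⟩ := exists_expansion t
  let e := stdOrthonormalBasis ℝ (E₁ ⊔ E₂ : Submodule ℝ H)
  obtain ⟨a, ha⟩ := h₁ _ le_sup_left e
  obtain ⟨b, hb⟩ := h₂ _ le_sup_right e
  have he : ∀ i j, ⟪(e i : H), (e j : H)⟫_ℝ = if i = j then 1 else 0 := fun i j => by
    rw [← Submodule.coe_inner]; exact orthonormal_iff_ite.1 e.orthonormal i j
  have hn : ∀ c : Fin _ → H, ‖∑ i, c i ⊗ₜ[ℝ] (e i : H)‖ = √(∑ i, ‖c i‖ ^ 2) := fun c => by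
    have h : ‖∑ i, c i ⊗ₜ[ℝ] (e i : H)‖ ^ 2 = ∑ i, ‖c i‖ ^ 2 := by
      rw [← real_inner_self_eq_norm_sq]
      simp only [sum_inner, inner_sum, TensorProduct.inner_tmul, he]
      simp
    rw [← h, Real.sqrt_sq (norm_nonneg _)]
  have hm : contractAlg H s t = ∑ i, a i ⊗ₜ[ℝ] b i := by
    rw [ha, hb]; simp [he]
  calc ‖contractAlg H s t‖ ≤ ∑ i, ‖a i‖ * ‖b i‖ := by
        rw [hm]; exact (norm_sum_le _ _).trans_eq (by simp)
    _ ≤ √(∑ i, ‖a i‖ ^ 2) * √(∑ i, ‖b i‖ ^ 2) := Real.sum_mul_le_sqrt_mul_sqrt _ _ _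
    _ = ‖s‖ * ‖t‖ := by rw [ha, hb, hn, hn]

variable (H) in
/-- The contraction `(a ⊗ b, c ⊗ d) ↦ ⟪b, d⟫ a ⊗ c` on `H^{⊗2}`. In terms of Hilbert-Schmidt
operators it sends `(S, T)` to `S Tᵀ`. It is extended by continuity in one variable at a time. -/
def contract : Tensor2 H →L[ℝ] Tensor2 H →L[ℝ] Tensor2 H :=
  (extendTensor (extendTensor (((ContinuousLinearMap.compL ℝ (H ⊗[ℝ] H) (H ⊗[ℝ] H) (Tensor2 H)
    UniformSpace.Completion.toComplL) ∘L
      (contractAlg H).mkContinuous₂ 1 (by simpa using norm_contractAlg_le)))).flip).flip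

lemma contract_coe (s t : H ⊗[ℝ] H) :
    contract H (s : Tensor2 H) (t : Tensor2 H) = (contractAlg H s t : H ⊗[ℝ] H) := by
  simp [contract]

lemma tensor2_ext {E : Type*} [NormedAddCommGroup E] [NormedSpace ℝ E] {L L' : Tensor2 H →L[ℝ] E}
    (h : ∀ a b : H, L ((a ⊗ₜ[ℝ] b : H ⊗[ℝ] H) : Tensor2 H) =
      L' ((a ⊗ₜ[ℝ] b : H ⊗[ℝ] H) : Tensor2 H)) : L = L' := by
  ext t
  refine UniformSpace.Completion.induction_on t (isClosed_eq L.continuous L'.continuous) fun s => ?_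
  induction s using TensorProduct.induction_on with
  | zero => rw [UniformSpace.Completion.coe_zero, map_zero, map_zero]
  | tmul a b => exact h a b
  | add s t hs ht => simp only [UniformSpace.Completion.coe_add, map_add, hs, ht]

@[simp]
lemma contract_tmul (a b c d : H) :
    contract H ((a ⊗ₜ[ℝ] b : H ⊗[ℝ] H) : Tensor2 H) ((c ⊗ₜ[ℝ] d : H ⊗[ℝ] H) : Tensor2 H) =
      ⟪b, d⟫_ℝ • ((a ⊗ₜ[ℝ] c : H ⊗[ℝ] H) : Tensor2 H) := by
  rw [contract_coe, contractAlg_tmul, UniformSpace.Completion.coe_smul]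

lemma norm_contract_le (s t : Tensor2 H) : ‖contract H s t‖ ≤ ‖s‖ * ‖t‖ := by
  refine UniformSpace.Completion.induction_on₂ s t
    (isClosed_le (by fun_prop) (by fun_prop)) fun s t => ?_
  rw [contract_coe]
  simpa only [UniformSpace.Completion.norm_coe] using norm_contractAlg_le s t

lemma tensor2_ext₂ {E : Type*} [NormedAddCommGroup E] [NormedSpace ℝ E]
    {L L' : Tensor2 H →L[ℝ] Tensor2 H →L[ℝ] E}
    (h : ∀ a b c d : H, L ((a ⊗ₜ[ℝ] b : H ⊗[ℝ] H) : Tensor2 H)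
        ((c ⊗ₜ[ℝ] d : H ⊗[ℝ] H) : Tensor2 H) =
      L' ((a ⊗ₜ[ℝ] b : H ⊗[ℝ] H) : Tensor2 H) ((c ⊗ₜ[ℝ] d : H ⊗[ℝ] H) : Tensor2 H)) : L = L' := by
  refine tensor2_ext (E := Tensor2 H →L[ℝ] E) (L := L) (L' := L') fun a b => ?_
  exact tensor2_ext (E := E) fun c d => h a b c d

lemma swap_contract (s t : Tensor2 H) : swap H (contract H s t) = contract H t s := by
  have : (ContinuousLinearMap.compL ℝ _ _ _ (swap H)) ∘L contract H = (contract H).flip :=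
    tensor2_ext₂ fun a b c d => by
      simp [real_inner_comm]
  exact congrArg (fun L => L s t) this

/-- In terms of operators, `(S Tᵀ) Uᵀ = S (U T)ᵀ`. -/
lemma contract_contract (s t u : Tensor2 H) :
    contract H (contract H s t) u = contract H s (contract H u (swap H t)) := by
  have : ∀ c d : H,
      ((contract H).flip u) ∘L ((contract H).flip ((c ⊗ₜ[ℝ] d : H ⊗[ℝ] H) : Tensor2 H)) =
      (contract H).flip (contract H u (swap H ((c ⊗ₜ[ℝ] d : H ⊗[ℝ] H) : Tensor2 H))) := by
    intro c d
    refine tensor2_ext fun a b => ?_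
    have : (⟪b, d⟫_ℝ • contract H ((a ⊗ₜ[ℝ] c : H ⊗[ℝ] H) : Tensor2 H)) =
        contract H ((a ⊗ₜ[ℝ] b : H ⊗[ℝ] H) : Tensor2 H) ∘L
          (contract H).flip ((d ⊗ₜ[ℝ] c : H ⊗[ℝ] H) : Tensor2 H) :=
      tensor2_ext fun x y => by simp [smul_smul, real_inner_comm, mul_comm]
    simpa using congrArg (fun L => L u) this
  have h2 : contract H (contract H s t) u = (((contract H).flip u) ∘L contract H s) t := rfl
  have h3 : ((contract H).flip u) ∘L contract H s =
      (contract H s) ∘L (contract H u) ∘L swap H :=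
    tensor2_ext fun c d => by simpa using congrArg (fun L => L s) (this c d)
  rw [h2, h3]; rfl

/-! ### Double integrals and vector-valued integrals -/

lemma norm_le_of_inner_self_le {E : Type*} [NormedAddCommGroup E] [InnerProductSpace ℝ E]
    {x : E} {c : ℝ} (hc : 0 ≤ c) (h : ⟪x, x⟫_ℝ ≤ c ^ 2) : ‖x‖ ≤ c := by
  rw [real_inner_self_eq_norm_sq] at h
  exact le_of_sq_le_sq h hc

namespace IsIsonormal

lemma memLp_mul (hX : IsIsonormal X P) (a b : H) {p : ENNReal} (hp : p ≠ ⊤) :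
    MemLp (fun ω => X a ω * X b ω) p P :=
  hX.memLp_of_hasTemperateGrowth ![a, b]
    ((hasTemperateGrowth_eval (0 : Fin 2)).mul (hasTemperateGrowth_eval (1 : Fin 2))) hp

/-- The case of four factors of Isserlis' theorem. -/
lemma integral_mul_four (hX : IsIsonormal X P) (a b c d : H) :
    ∫ ω, (X a ω * X b ω) * (X c ω * X d ω) ∂P =
      ⟪a, b⟫_ℝ * ⟪c, d⟫_ℝ + ⟪a, c⟫_ℝ * ⟪b, d⟫_ℝ + ⟪a, d⟫_ℝ * ⟪b, c⟫_ℝ := by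
  have := hX.gaussian.isProbabilityMeasure
  have hi := fun i : Fin 3 => hasTemperateGrowth_eval i
  have key := hX.integral_mul_eq a ![b, c, d] ((hi 0).mul ((hi 1).mul (hi 2)))
  have hfd : ∀ x v : Fin 3 → ℝ, fderiv ℝ ((fun x : Fin 3 → ℝ => x 0) *
      ((fun x : Fin 3 → ℝ => x 1) * fun x : Fin 3 → ℝ => x 2)) x v =
      v 0 * (x 1 * x 2) + v 1 * (x 0 * x 2) + v 2 * (x 0 * x 1) := by
    intro x v
    have h := fun i : Fin 3 => hasFDerivAt_apply (𝕜 := ℝ) i x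
    rw [((h 0).mul ((h 1).mul (h 2))).fderiv]
    simp
    ring
  simp only [hfd, Pi.mul_apply, Matrix.cons_val_zero, Matrix.cons_val_one, Matrix.cons_val] at key
  have i : ∀ x y : H, Integrable (fun ω => X x ω * X y ω) P :=
    fun x y => (hX.memLp_mul x y (p := 1) (by simp)).integrable le_rfl
  have e : ∀ ω, (X a ω * X b ω) * (X c ω * X d ω) = X a ω * (X b ω * (X c ω * X d ω)) :=
    fun ω => by ring
  simp only [e]
  have j : ∀ (r : ℝ) (x y : H), Integrable (fun ω => r * (X x ω * X y ω)) P :=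
    fun r x y => (i x y).const_mul r
  have j2 : Integrable (fun ω => ⟪b, a⟫_ℝ * (X c ω * X d ω) + ⟪c, a⟫_ℝ * (X b ω * X d ω)) P :=
    (j _ c d).add (j _ b d)
  rw [key, integral_add j2 (j _ b c), integral_add (j _ c d) (j _ b d), integral_const_mul,
    integral_const_mul, integral_const_mul, hX.covariance, hX.covariance, hX.covariance]
  simp only [real_inner_comm a]

lemma memLp_mul_sub_inner (hX : IsIsonormal X P) (a b : H) :
    MemLp (fun ω => X a ω * X b ω - ⟪a, b⟫_ℝ) 2 P := by
  have := hX.gaussian.isProbabilityMeasure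
  exact (hX.memLp_mul a b (by simp)).sub (memLp_const _)

/-- The random variable `X(a) X(b) - ⟪a, b⟫`, bilinear in `(a, b)`. -/
def wickProduct (hX : IsIsonormal X P) : H →ₗ[ℝ] H →ₗ[ℝ] Lp ℝ 2 P :=
  LinearMap.mk₂ ℝ (fun a b => (hX.memLp_mul_sub_inner a b).toLp)
    (fun a a' b => by
      rw [← MemLp.toLp_add]
      refine MemLp.toLp_congr _ _ ?_
      filter_upwards [hX.ae_add a a'] with ω h
      simp only [Pi.add_apply, h, inner_add_left]; ring)
    (fun c a b => by
      rw [← MemLp.toLp_const_smul]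
      refine MemLp.toLp_congr _ _ ?_
      filter_upwards [hX.ae_smul c a] with ω h
      simp only [Pi.smul_apply, h, inner_smul_left, RCLike.conj_to_real, smul_eq_mul]; ring)
    (fun a b b' => by
      rw [← MemLp.toLp_add]
      refine MemLp.toLp_congr _ _ ?_
      filter_upwards [hX.ae_add b b'] with ω h
      simp only [Pi.add_apply, h, inner_add_right]; ring)
    (fun c a b => by
      rw [← MemLp.toLp_const_smul]
      refine MemLp.toLp_congr _ _ ?_
      filter_upwards [hX.ae_smul c b] with ω h
      simp only [Pi.smul_apply, h, inner_smul_right, smul_eq_mul]; ring)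

lemma coeFn_wickProduct (hX : IsIsonormal X P) (a b : H) :
    hX.wickProduct a b =ᵐ[P] fun ω => X a ω * X b ω - ⟪a, b⟫_ℝ :=
  (hX.memLp_mul_sub_inner a b).coeFn_toLp

lemma inner_wickProduct (hX : IsIsonormal X P) (a b c d : H) :
    ⟪hX.wickProduct a b, hX.wickProduct c d⟫_ℝ =
      ⟪a, c⟫_ℝ * ⟪b, d⟫_ℝ + ⟪a, d⟫_ℝ * ⟪b, c⟫_ℝ := by
  have := hX.gaussian.isProbabilityMeasure
  rw [L2.inner_def]
  have e : (fun ω => ⟪hX.wickProduct a b ω, hX.wickProduct c d ω⟫_ℝ) =ᵐ[P] fun ω =>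
      (X a ω * X b ω) * (X c ω * X d ω) - ⟪c, d⟫_ℝ * (X a ω * X b ω)
        - (⟪a, b⟫_ℝ * (X c ω * X d ω) - ⟪a, b⟫_ℝ * ⟪c, d⟫_ℝ) := by
    filter_upwards [hX.coeFn_wickProduct a b, hX.coeFn_wickProduct c d] with ω h1 h2
    rw [h1, h2]
    simp only [RCLike.inner_apply, RCLike.conj_to_real]
    ring
  have i : ∀ x y : H, Integrable (fun ω => X x ω * X y ω) P :=
    fun x y => (hX.memLp_mul x y (p := 1) (by simp)).integrable le_rfl
  have i4 : Integrable (fun ω => (X a ω * X b ω) * (X c ω * X d ω)) P :=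
    (hX.memLp_mul a b (p := 2) (by simp)).integrable_mul (hX.memLp_mul c d (p := 2) (by simp))
  have j1 := (i a b).const_mul ⟪c, d⟫_ℝ
  have j2 := (i c d).const_mul ⟪a, b⟫_ℝ
  have j3 : Integrable (fun ω => (X a ω * X b ω) * (X c ω * X d ω) -
      ⟪c, d⟫_ℝ * (X a ω * X b ω)) P := i4.sub j1
  have j4 : Integrable (fun ω => ⟪a, b⟫_ℝ * (X c ω * X d ω) - ⟪a, b⟫_ℝ * ⟪c, d⟫_ℝ) P :=
    j2.sub (integrable_const _)
  rw [integral_congr_ae e, integral_sub j3 j4, integral_sub i4 j1,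
    integral_sub j2 (integrable_const _), integral_const_mul,
    integral_const_mul, hX.integral_mul_four, hX.covariance, hX.covariance]
  simp
  ring

/-- On the algebraic tensor product, `a ⊗ b ↦ X(a) X(b) - ⟪a, b⟫`. -/
def doubleIntegralAlg (hX : IsIsonormal X P) : H ⊗[ℝ] H →ₗ[ℝ] Lp ℝ 2 P :=
  TensorProduct.lift hX.wickProduct

lemma inner_doubleIntegralAlg (hX : IsIsonormal X P) (s t : H ⊗[ℝ] H) :
    ⟪hX.doubleIntegralAlg s, hX.doubleIntegralAlg t⟫_ℝ =
      ⟪s, t⟫_ℝ + ⟪s, TensorProduct.comm ℝ H H t⟫_ℝ := by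
  induction s using TensorProduct.induction_on with
  | zero => simp
  | add s s' h h' => simp only [map_add, inner_add_left, h, h']; ring
  | tmul a b =>
    induction t using TensorProduct.induction_on with
    | zero => simp
    | add t t' h h' => simp only [map_add, inner_add_right, h, h']; ring
    | tmul c d => simp [doubleIntegralAlg, inner_wickProduct]

/-- The double Wiener-Itô integral on all of `H^{⊗2}`: it maps `a ⊗ b` to `X(a) X(b) - ⟪a, b⟫`, and
depends on the symmetrization of its argument only. -/
def doubleIntegral (hX : IsIsonormal X P) : Tensor2 H →L[ℝ] Lp ℝ 2 P :=
  extendTensor (hX.doubleIntegralAlg.mkContinuous 2 fun t =>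
    norm_le_of_inner_self_le (by positivity) <| by
      have h1 : ⟪t, TensorProduct.comm ℝ H H t⟫_ℝ ≤ ‖t‖ * ‖TensorProduct.comm ℝ H H t‖ :=
        real_inner_le_norm t (TensorProduct.comm ℝ H H t)
      have h2 : ⟪t, t⟫_ℝ = ‖t‖ ^ 2 := real_inner_self_eq_norm_sq t
      rw [TensorProduct.norm_comm] at h1
      rw [inner_doubleIntegralAlg, h2]
      nlinarith [norm_nonneg t])

lemma doubleIntegral_coe (hX : IsIsonormal X P) (t : H ⊗[ℝ] H) :
    hX.doubleIntegral (t : Tensor2 H) = hX.doubleIntegralAlg t := by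
  simp [doubleIntegral]

lemma coeFn_doubleIntegral_tmul (hX : IsIsonormal X P) (a b : H) :
    hX.doubleIntegral ((a ⊗ₜ[ℝ] b : H ⊗[ℝ] H) : Tensor2 H) =ᵐ[P]
      fun ω => X a ω * X b ω - ⟪a, b⟫_ℝ := by
  rw [doubleIntegral_coe]
  exact hX.coeFn_wickProduct a b

lemma inner_doubleIntegral (hX : IsIsonormal X P) (s t : Tensor2 H) :
    ⟪hX.doubleIntegral s, hX.doubleIntegral t⟫_ℝ = ⟪s, t⟫_ℝ + ⟪s, swap H t⟫_ℝ := by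
  refine UniformSpace.Completion.induction_on₂ s t
    (isClosed_eq (by fun_prop) (by fun_prop)) fun s t => ?_
  rw [swap_coe, doubleIntegral_coe, doubleIntegral_coe, inner_doubleIntegralAlg,
    UniformSpace.Completion.inner_coe, UniformSpace.Completion.inner_coe]

/-- The random vector `X(a) b`, bilinear in `(a, b)`. -/
def smulVector (hX : IsIsonormal X P) : H →ₗ[ℝ] H →ₗ[ℝ] Lp H 2 P :=
  LinearMap.mk₂ ℝ (fun a b => (ContinuousLinearMap.toSpanSingleton ℝ b).compLp (hX.toLpₗᵢ a))
    (fun a a' b => by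
      rw [map_add]; exact ((ContinuousLinearMap.toSpanSingleton ℝ b).compLpₗ 2 P).map_add _ _)
    (fun c a b => by
      rw [map_smul]; exact ((ContinuousLinearMap.toSpanSingleton ℝ b).compLpₗ 2 P).map_smul c _)
    (fun a b b' => by
      rw [ContinuousLinearMap.toSpanSingleton_add, ContinuousLinearMap.add_compLp])
    (fun c a b => by
      rw [ContinuousLinearMap.toSpanSingleton_smul, ContinuousLinearMap.smul_compLp])

lemma coeFn_smulVector (hX : IsIsonormal X P) (a b : H) :
    hX.smulVector a b =ᵐ[P] fun ω => X a ω • b := by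
  filter_upwards [(ContinuousLinearMap.toSpanSingleton ℝ b).coeFn_compLp (hX.toLpₗᵢ a),
    hX.coeFn_toLpₗᵢ a] with ω h1 h2
  change (ContinuousLinearMap.compLp _ _ : Lp H 2 P) ω = _
  rw [h1, h2]; simp

lemma inner_smulVector (hX : IsIsonormal X P) (a b c d : H) :
    ⟪hX.smulVector a b, hX.smulVector c d⟫_ℝ = ⟪a, c⟫_ℝ * ⟪b, d⟫_ℝ := by
  rw [L2.inner_def, ← hX.covariance a c, ← integral_mul_const]
  refine integral_congr_ae ?_
  filter_upwards [hX.coeFn_smulVector a b, hX.coeFn_smulVector c d] with ω h1 h2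
  rw [h1, h2, inner_smul_left, inner_smul_right]
  simp; ring

lemma inner_lift_smulVector (hX : IsIsonormal X P) (s t : H ⊗[ℝ] H) :
    ⟪TensorProduct.lift hX.smulVector s, TensorProduct.lift hX.smulVector t⟫_ℝ = ⟪s, t⟫_ℝ := by
  induction s using TensorProduct.induction_on with
  | zero => simp
  | add s s' h h' => simp only [map_add, inner_add_left, h, h']
  | tmul a b =>
    induction t using TensorProduct.induction_on with
    | zero => simp
    | add t t' h h' => simp only [map_add, inner_add_right, h, h']
    | tmul c d => simp [inner_smulVector]

variable [CompleteSpace H]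

/-- The single Wiener-Itô integral in the first variable: it maps `a ⊗ b` to `X(a) b`. On symmetric
tensors it is one half of the derivative of the double integral. -/
def partialIntegral (hX : IsIsonormal X P) : Tensor2 H →L[ℝ] Lp H 2 P :=
  extendTensor ((TensorProduct.lift hX.smulVector).mkContinuous 1 fun t =>
    norm_le_of_inner_self_le (by positivity) <| by
      rw [inner_lift_smulVector, one_mul]
      exact (real_inner_self_eq_norm_sq t).le)

lemma coeFn_partialIntegral_tmul (hX : IsIsonormal X P) (a b : H) :
    hX.partialIntegral ((a ⊗ₜ[ℝ] b : H ⊗[ℝ] H) : Tensor2 H) =ᵐ[P] fun ω => X a ω • b := by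
  rw [partialIntegral, extendTensor_coe]
  exact hX.coeFn_smulVector a b

end IsIsonormal

/-! ### Orthogonality of the second chaos to the other chaoses -/

lemma hasTemperateGrowth_aeval {ι R : Type*} [Fintype ι] [CommSemiring R] [Algebra R ℝ]
    (i : ι) (p : Polynomial R) :
    (fun x : ι → ℝ => Polynomial.aeval (x i) p).HasTemperateGrowth := by
  induction p using Polynomial.induction_on' with
  | add p q hp hq => simpa only [map_add] using! hp.add hq
  | monomial n r =>
    simpa only [Polynomial.aeval_monomial] using!
      (Function.HasTemperateGrowth.const (algebraMap R ℝ r)).mul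
        ((hasTemperateGrowth_eval i).pow n)

lemma fderiv_aeval {ι R : Type*} [Fintype ι] [CommSemiring R] [Algebra R ℝ]
    (i : ι) (p : Polynomial R) (x v : ι → ℝ) :
    fderiv ℝ (fun x : ι → ℝ => Polynomial.aeval (x i) p) x v =
      Polynomial.aeval (x i) (Polynomial.derivative p) * v i := by
  have h := (p.hasDerivAt_aeval (x i)).comp_hasFDerivAt x (hasFDerivAt_apply (𝕜 := ℝ) i x)
  have h' : HasFDerivAt (fun x : ι → ℝ => Polynomial.aeval (x i) p) _ x := h
  rw [h'.fderiv]; simp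

namespace IsIsonormal

/-- In the direction `h` the adjoint of the derivative maps `H_n(X(h))` to `H_{n+1}(X(h))`, so that
`E[H_{n+1}(X(h)) Q(X(g))] = ⟪g, h⟫ E[H_n(X(h)) Q'(X(g))]`. -/
lemma integral_mul_hermite_succ (hX : IsIsonormal X P) {h : H} (hh : ‖h‖ = 1) (g : H) (n : ℕ)
    (Q : Polynomial ℝ) :
    ∫ ω, Polynomial.aeval (X g ω) Q * Polynomial.aeval (X h ω) (Polynomial.hermite (n + 1)) ∂P =
      ⟪g, h⟫_ℝ * ∫ ω, Polynomial.aeval (X g ω) (Polynomial.derivative Q) *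
        Polynomial.aeval (X h ω) (Polynomial.hermite n) ∂P := by
  have key := hX.integral_fderiv_mul_eq h (fun _ : Unit => g) (fun _ : Unit => h)
    (hasTemperateGrowth_aeval () Q) (hasTemperateGrowth_aeval () (Polynomial.hermite n))
  simp only [fderiv_aeval, real_inner_self_eq_norm_sq, hh] at key
  rw [← integral_const_mul]
  refine Eq.trans ?_ (key.symm.trans ?_) <;> congr 1 <;> ext ω
  · simp [Polynomial.hermite_succ]
  · ring

/-- For `p + 1 ≥ 3`, three integrations by parts replace the quadratic polynomial by its third
derivative; for `p + 1 = 1`, a single one leaves a multiple of `E[X(g)] = 0`. -/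
lemma integral_hermite_two_mul_hermite (hX : IsIsonormal X P) {h : H} (hh : ‖h‖ = 1) (g : H)
    {p : ℕ} (hp : p + 1 ≠ 2) :
    ∫ ω, Polynomial.aeval (X g ω) (Polynomial.hermite 2) *
      Polynomial.aeval (X h ω) (Polynomial.hermite (p + 1)) ∂P = 0 := by
  have e : ∀ x : ℝ, Polynomial.aeval x (Polynomial.hermite 2) =
      Polynomial.aeval x (Polynomial.X ^ 2 - 1 : Polynomial ℝ) := fun x => by
    simp [Polynomial.hermite_succ]; ring
  simp only [e]
  match p, hp with
  | 0, _ =>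
    rw [hX.integral_mul_hermite_succ hh]
    simp [integral_const_mul, hX.centered]
  | n + 2, _ =>
    rw [hX.integral_mul_hermite_succ hh, hX.integral_mul_hermite_succ hh,
      hX.integral_mul_hermite_succ hh]
    simp

lemma inner_chaos_two_eq_zero (hX : IsIsonormal X P) {p : ℕ} (hp : p + 1 ≠ 2) {F G : Lp ℝ 2 P}
    (hF : F ∈ chaos X P 2) (hG : G ∈ chaos X P (p + 1)) : ⟪F, G⟫_ℝ = 0 := by
  refine map_eq_of_mem_closure_span (innerSL ℝ F) 0 ?_ hG
  rintro v ⟨h, hh, hv⟩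
  have := map_eq_of_mem_closure_span (innerSL ℝ v) 0 ?_ hF
  · simpa [real_inner_comm] using this
  rintro u ⟨g, -, hu⟩
  rw [innerSL_apply_apply, L2.inner_def, _root_.zero_apply,
    ← hX.integral_hermite_two_mul_hermite hh g hp]
  refine integral_congr_ae ?_
  filter_upwards [hu, hv] with ω h1 h2
  rw [h1, h2]; simp

lemma pseudoInverseL_eq (hX : IsIsonormal X P) {F : Lp ℝ 2 P} (hF : F ∈ chaos X P 2) :
    pseudoInverseL X P F = (-(1 / 2) : ℝ) • F := by
  have h0 : ∀ p : ℕ, p ≠ 1 →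
      ((1 : ℝ) / ((p : ℝ) + 1)) • (chaos X P (p + 1)).starProjection F = 0 := by
    intro p hp
    rw [(Submodule.starProjection_apply_eq_zero_iff _).2, smul_zero]
    rw [Submodule.mem_orthogonal']
    exact fun G hG => hX.inner_chaos_two_eq_zero (by omega) hF hG
  rw [pseudoInverseL, tsum_eq_single 1 h0, Submodule.starProjection_eq_self_iff.2 hF, ← neg_smul]
  norm_num

end IsIsonormal

/-! ### The derivative of double integrals and products of derivatives -/

lemma map_tensor2_mem {E : Type*} [NormedAddCommGroup E] [NormedSpace ℝ E]
    (L : Tensor2 H →L[ℝ] E) {M : Submodule ℝ E} (hM : IsClosed (M : Set E))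
    (h : ∀ a b : H, L ((a ⊗ₜ[ℝ] b : H ⊗[ℝ] H) : Tensor2 H) ∈ M) (t : Tensor2 H) : L t ∈ M := by
  refine UniformSpace.Completion.induction_on t (hM.preimage L.continuous) fun s => ?_
  induction s using TensorProduct.induction_on with
  | zero => rw [UniformSpace.Completion.coe_zero, map_zero]; exact M.zero_mem
  | tmul a b => exact h a b
  | add s t hs ht => rw [UniformSpace.Completion.coe_add, map_add]; exact M.add_mem hs ht

namespace IsIsonormal

lemma const_mem_closure_smoothPairs [IsProbabilityMeasure P] (c : ℝ) :
    ((Lp.const 2 P c, 0) : Lp ℝ 2 P × Lp H 2 P) ∈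
      (Submodule.span ℝ (smoothPairs X P)).topologicalClosure := by
  refine Submodule.le_topologicalClosure _ (Submodule.subset_span
    ⟨0, Fin.elim0, fun _ => c, .const c, ?_, ?_⟩)
  · exact Lp.coeFn_const 2 P c
  · simpa using! Lp.coeFn_zero H 2 P

variable [CompleteSpace H]

/-- `I₂(t) ∈ 𝔻^{1,2}` with `D I₂(t) = Φ(t + swap t)`, where `Φ` is `partialIntegral`: for elementary
tensors this is the Leibniz rule `D (X(a) X(b)) = X(a) b + X(b) a`. -/
lemma doubleIntegral_mem_closure_smoothPairs (hX : IsIsonormal X P) (t : Tensor2 H) :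
    (hX.doubleIntegral t, hX.partialIntegral (t + swap H t)) ∈
      (Submodule.span ℝ (smoothPairs X P)).topologicalClosure := by
  refine map_tensor2_mem (hX.doubleIntegral.prod
    (hX.partialIntegral ∘L (ContinuousLinearMap.id ℝ _ + swap H)))
    (Submodule.isClosed_topologicalClosure _) (fun a b => ?_) t
  refine Submodule.le_topologicalClosure _ (Submodule.subset_span
    ⟨2, ![a, b], fun x => x 0 * x 1 - ⟪a, b⟫_ℝ, ?_, ?_, ?_⟩)
  · exact ((hasTemperateGrowth_eval 0).mul (hasTemperateGrowth_eval 1)).sub (.const _)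
  · exact hX.coeFn_doubleIntegral_tmul a b
  · have hfd : ∀ x v : Fin 2 → ℝ, fderiv ℝ (fun x : Fin 2 → ℝ => x 0 * x 1 - ⟪a, b⟫_ℝ) x v =
        v 0 * x 1 + v 1 * x 0 := by
      intro x v
      have h := fun i : Fin 2 => hasFDerivAt_apply (𝕜 := ℝ) i x
      have h' := ((h 0).mul (h 1)).sub_const ⟪a, b⟫_ℝ
      have h'' : HasFDerivAt (fun x : Fin 2 → ℝ => x 0 * x 1 - ⟪a, b⟫_ℝ) _ x := h'
      rw [h''.fderiv]; simp; ring
    have e := Lp.coeFn_add (hX.partialIntegral ((a ⊗ₜ[ℝ] b : H ⊗[ℝ] H) : Tensor2 H))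
      (hX.partialIntegral ((b ⊗ₜ[ℝ] a : H ⊗[ℝ] H) : Tensor2 H))
    filter_upwards [e, hX.coeFn_partialIntegral_tmul a b, hX.coeFn_partialIntegral_tmul b a]
      with ω h1 h2 h3
    simp only [ContinuousLinearMap.prod_apply, ContinuousLinearMap.comp_apply, _root_.add_apply,
      ContinuousLinearMap.id_apply, swap_coe, TensorProduct.comm_tmul, map_add]
    rw [h1, Pi.add_apply, h2, h3]
    simp [hfd, add_comm]

/-- `⟪Φ(s), Φ(t)⟫ = I₂(s tᵀ) + ⟪s, t⟫`, where `Φ` is `partialIntegral`: the product formula for two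
random vectors which are linear in `X`. -/
lemma inner_partialIntegral_ae (hX : IsIsonormal X P) (s t : Tensor2 H) :
    (fun ω => ⟪hX.partialIntegral s ω, hX.partialIntegral t ω⟫_ℝ) =ᵐ[P]
      fun ω => hX.doubleIntegral (contract H s t) ω + ⟪s, t⟫_ℝ := by
  have := hX.gaussian.isProbabilityMeasure
  let B : ∀ (E : Type _) [NormedAddCommGroup E] [InnerProductSpace ℝ E], E →L[ℝ] E →L[ℝ] ℝ :=
    fun E _ _ => (innerₗ E).mkContinuous₂ 1 fun x y => by simpa using abs_real_inner_le_norm x y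
  -- the identity is one between continuous bilinear maps with values in `L¹`
  let ι : Lp ℝ 2 P →L[ℝ] Lp ℝ 1 P :=
    ((ContinuousLinearMap.mul ℝ ℝ).holderL P 2 2 1).flip (Lp.const 2 P 1)
  have hι : ∀ F : Lp ℝ 2 P, ι F =ᵐ[P] F := fun F => by
    filter_upwards [(ContinuousLinearMap.mul ℝ ℝ).coeFn_holder (r := 1) F (Lp.const 2 P 1),
      Lp.coeFn_const 2 P (1 : ℝ)] with ω h1 h2
    change ((ContinuousLinearMap.mul ℝ ℝ).holder 1 F (Lp.const 2 P 1) : Lp ℝ 1 P) ω = _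
    rw [h1, h2]; simp
  let L : Tensor2 H →L[ℝ] Tensor2 H →L[ℝ] Lp ℝ 1 P :=
    ((B H).holderL P 2 2 1).bilinearComp hX.partialIntegral hX.partialIntegral
  let L' : Tensor2 H →L[ℝ] Tensor2 H →L[ℝ] Lp ℝ 1 P :=
    (ContinuousLinearMap.compL ℝ _ _ _ (ι ∘L hX.doubleIntegral)) ∘L contract H +
      (ContinuousLinearMap.compL ℝ _ _ _ (Lp.constL 1 P ℝ)) ∘L B (Tensor2 H)
  have hL : ∀ s t, L s t =ᵐ[P] fun ω => ⟪hX.partialIntegral s ω, hX.partialIntegral t ω⟫_ℝ :=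
    fun s t => (B H).coeFn_holder (r := 1) (hX.partialIntegral s) (hX.partialIntegral t)
  have hL' : ∀ s t, L' s t =ᵐ[P] fun ω => hX.doubleIntegral (contract H s t) ω + ⟪s, t⟫_ℝ := by
    intro s t
    filter_upwards [Lp.coeFn_add (ι (hX.doubleIntegral (contract H s t)))
      (Lp.const 1 P ⟪s, t⟫_ℝ), hι (hX.doubleIntegral (contract H s t)),
      Lp.coeFn_const 1 P ⟪s, t⟫_ℝ] with ω h1 h2 h3
    change (ι (hX.doubleIntegral (contract H s t)) + Lp.const 1 P ⟪s, t⟫_ℝ : Lp ℝ 1 P) ω = _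
    rw [h1, Pi.add_apply, h2, h3]; rfl
  have hLL : L = L' := by
    refine tensor2_ext₂ fun a b c d => Lp.ext ?_
    refine (hL _ _).trans (Filter.EventuallyEq.trans ?_ (hL' _ _).symm)
    rw [contract_tmul, map_smul]
    filter_upwards [hX.coeFn_partialIntegral_tmul a b, hX.coeFn_partialIntegral_tmul c d,
      hX.coeFn_doubleIntegral_tmul a c, Lp.coeFn_smul ⟪b, d⟫_ℝ
        (hX.doubleIntegral ((a ⊗ₜ[ℝ] c : H ⊗[ℝ] H) : Tensor2 H))] with ω h1 h2 h3 h4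
    rw [h1, h2, h4, Pi.smul_apply, h3, UniformSpace.Completion.inner_coe, TensorProduct.inner_tmul,
      inner_smul_left, inner_smul_right]
    simp; ring
  have := hL s t
  rw [hLL] at this
  exact this.symm.trans (hL' s t)

end IsIsonormal

/-! ### The Gamma operators of a double integral -/

/-- The kernel `f, f ⋆ f, (f ⋆ f) ⋆ f, …` of the iterated Gamma operators; for
symmetric `f` the `r`-th term is the power `f^{r+1}` of the Hilbert-Schmidt operator `f`. -/
def gammaKernel (f : Tensor2 H) : ℕ → Tensor2 H
  | 0 => f
  | r + 1 => contract H (gammaKernel f r) f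

/-- Powers of a symmetric operator are symmetric and commute with it. -/
lemma swap_gammaKernel {f : Tensor2 H} (hf : swap H f = f) (r : ℕ) :
    swap H (gammaKernel f r) = gammaKernel f r ∧
      contract H f (gammaKernel f r) = contract H (gammaKernel f r) f := by
  induction r with
  | zero => exact ⟨hf, rfl⟩
  | succ r ih =>
    refine ⟨by rw [gammaKernel, swap_contract, ih.2], ?_⟩
    calc contract H f (contract H (gammaKernel f r) f)
        = contract H f (contract H f (swap H (gammaKernel f r))) := by rw [ih.1, ih.2]
      _ = contract H (contract H f (gammaKernel f r)) f := (contract_contract _ _ _).symm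
      _ = contract H (contract H (gammaKernel f r) f) f := by rw [ih.2]

/-- The contraction behind the variance inequality: consecutive differences of the kernels are
obtained from each other by multiplication with `f`. -/
lemma norm_gammaKernel_sub_le (f : Tensor2 H) (r : ℕ) :
    ‖gammaKernel f (r + 2) - gammaKernel f (r + 1)‖ ≤
      ‖gammaKernel f (r + 1) - gammaKernel f r‖ * ‖f‖ := by
  have : gammaKernel f (r + 2) - gammaKernel f (r + 1) =
      contract H (gammaKernel f (r + 1) - gammaKernel f r) f := by
    rw [map_sub, sub_apply]; rfl
  rw [this]
  exact norm_contract_le _ _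

lemma swap_of_mem_symTensor2 (f : symTensor2 H) : swap H (f : Tensor2 H) = f :=
  map_eq_of_mem_closure_span (swap H) (ContinuousLinearMap.id ℝ _)
    (by rintro _ ⟨h, rfl⟩; simp) f.2

namespace IsIsonormal

lemma eq_doubleIntegral (hX : IsIsonormal X P) {f : symTensor2 H} {F : Lp ℝ 2 P}
    (hF : IsI2 X P f F) : F = hX.doubleIntegral f ∧ F ∈ chaos X P 2 := by
  constructor
  · refine map_eq_of_mem_closure_span (ContinuousLinearMap.snd ℝ (Tensor2 H) (Lp ℝ 2 P))
      (hX.doubleIntegral ∘L ContinuousLinearMap.fst ℝ (Tensor2 H) (Lp ℝ 2 P)) ?_ hF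
    rintro ⟨t, G⟩ ⟨h, hh, ht, hG⟩
    simp only at ht
    subst ht
    refine Lp.ext ?_
    filter_upwards [hG, hX.coeFn_doubleIntegral_tmul h h] with ω h1 h2
    simp only [ContinuousLinearMap.coe_snd', ContinuousLinearMap.comp_apply,
      ContinuousLinearMap.coe_fst']
    rw [h1, h2, real_inner_self_eq_norm_sq, hh]
    simp [Polynomial.hermite_succ]
  · refine map_mem_of_mem_closure_span (ContinuousLinearMap.snd ℝ (Tensor2 H) (Lp ℝ 2 P))
      (Submodule.isClosed_topologicalClosure _) ?_ hF
    rintro ⟨t, G⟩ ⟨h, hh, -, hG⟩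
    exact Submodule.le_topologicalClosure _ (Submodule.subset_span ⟨h, hh, hG⟩)

lemma integral_doubleIntegral (hX : IsIsonormal X P) (t : Tensor2 H) :
    ∫ ω, hX.doubleIntegral t ω ∂P = 0 := by
  have := hX.gaussian.isProbabilityMeasure
  have h : (innerSL ℝ (Lp.const 2 P (1 : ℝ))) ∘L hX.doubleIntegral = 0 := by
    refine tensor2_ext fun a b => ?_
    rw [ContinuousLinearMap.comp_apply, innerSL_apply_apply, L2.inner_def]
    have e : (fun ω => ⟪Lp.const 2 P (1 : ℝ) ω,
        hX.doubleIntegral ((a ⊗ₜ[ℝ] b : H ⊗[ℝ] H) : Tensor2 H) ω⟫_ℝ) =ᵐ[P]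
        fun ω => X a ω * X b ω - ⟪a, b⟫_ℝ := by
      filter_upwards [Lp.coeFn_const 2 P (1 : ℝ), hX.coeFn_doubleIntegral_tmul a b] with ω h1 h2
      rw [h1, h2]; simp
    rw [integral_congr_ae e, integral_sub ((hX.memLp_mul a b (p := 1) (by simp)).integrable le_rfl)
      (integrable_const _), hX.covariance]
    simp
  have h' := congrArg (fun L => L t) h
  simp only [ContinuousLinearMap.comp_apply, innerSL_apply_apply, L2.inner_def] at h'
  rw [← h'.trans (by simp : (0 : Tensor2 H →L[ℝ] ℝ) t = 0)]
  refine integral_congr_ae ?_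
  filter_upwards [Lp.coeFn_const 2 P (1 : ℝ)] with ω h1
  rw [h1]; simp

lemma integral_doubleIntegral_sq (hX : IsIsonormal X P) {t : Tensor2 H} (ht : swap H t = t) :
    ∫ ω, hX.doubleIntegral t ω ^ 2 ∂P = 2 * ‖t‖ ^ 2 := by
  have h := hX.inner_doubleIntegral t t
  rw [ht, real_inner_self_eq_norm_sq t, L2.inner_def] at h
  rw [two_mul, ← h]
  congr 1; ext ω; simp

/-- The isometry property of double integrals, in terms of the variance. -/
lemma variance_of_ae_eq_doubleIntegral_add_const (hX : IsIsonormal X P) {t : Tensor2 H}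
    (ht : swap H t = t) {c : ℝ} {Y : Ω → ℝ}
    (hY : Y =ᵐ[P] fun ω => hX.doubleIntegral t ω + c) : Var[Y; P] = 2 * ‖t‖ ^ 2 := by
  have := hX.gaussian.isProbabilityMeasure
  have hm := Lp.aestronglyMeasurable (hX.doubleIntegral t)
  rw [variance_congr hY, variance_add_const hm,
    variance_of_integral_eq_zero hm.aemeasurable (hX.integral_doubleIntegral t)]
  exact hX.integral_doubleIntegral_sq ht

variable [CompleteSpace H]

lemma malliavinDeriv_doubleIntegral_add_const [IsProbabilityMeasure P] (hX : IsIsonormal X P)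
    {t : Tensor2 H} (ht : swap H t = t) (a c : ℝ) :
    a • hX.doubleIntegral t + Lp.const 2 P c ∈ (malliavinD X P).domain ∧
      malliavinDeriv X P (a • hX.doubleIntegral t + Lp.const 2 P c) =
        (2 * a) • hX.partialIntegral t := by
  refine hX.malliavinDeriv_eq ?_
  have h := Submodule.add_mem _
    (Submodule.smul_mem _ a (hX.doubleIntegral_mem_closure_smoothPairs t))
    (const_mem_closure_smoothPairs (X := X) (P := P) c)
  rwa [ht, ← two_smul ℝ t, map_smul, Prod.smul_mk, Prod.mk_add_mk, add_zero, smul_smul,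
    mul_comm a] at h

variable {f : symTensor2 H} {F : Lp ℝ 2 P}

lemma pseudoInverseL_mem_domain (hX : IsIsonormal X P) (hF : IsI2 X P f F) :
    pseudoInverseL X P F ∈ (malliavinD X P).domain ∧
      malliavinDeriv X P (pseudoInverseL X P F) = - hX.partialIntegral f := by
  have := hX.gaussian.isProbabilityMeasure
  obtain ⟨h1, h2⟩ := hX.eq_doubleIntegral hF
  have := hX.malliavinDeriv_doubleIntegral_add_const (swap_of_mem_symTensor2 f) (-(1 / 2)) 0
  rw [hX.pseudoInverseL_eq h2, h1]
  simpa using this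

lemma gammaStep_ae_eq [IsProbabilityMeasure P] (hX : IsIsonormal X P) (hF : IsI2 X P f F)
    {t : Tensor2 H} (ht : swap H t = t) (a c : ℝ) :
    gammaStep X P F (a • hX.doubleIntegral t + Lp.const 2 P c) =ᵐ[P]
      (((2 * a) • hX.doubleIntegral (contract H t f) +
        Lp.const 2 P (2 * a * ⟪t, (f : Tensor2 H)⟫_ℝ) : Lp ℝ 2 P) : Ω → ℝ) := by
  have e : gammaStep X P F (a • hX.doubleIntegral t + Lp.const 2 P c) =
      fun ω => ⟪((2 * a) • hX.partialIntegral t : Lp H 2 P) ω,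
        -((- hX.partialIntegral f : Lp H 2 P) ω)⟫_ℝ := by
    ext ω
    rw [gammaStep, (hX.malliavinDeriv_doubleIntegral_add_const ht a c).2,
      (hX.pseudoInverseL_mem_domain hF).2]
  rw [e]
  filter_upwards [hX.inner_partialIntegral_ae t f, Lp.coeFn_neg (hX.partialIntegral f),
    Lp.coeFn_smul (2 * a) (hX.partialIntegral t),
    Lp.coeFn_add ((2 * a) • hX.doubleIntegral (contract H t f))
      (Lp.const 2 P (2 * a * ⟪t, (f : Tensor2 H)⟫_ℝ)),
    Lp.coeFn_smul (2 * a) (hX.doubleIntegral (contract H t f)),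
    Lp.coeFn_const 2 P (2 * a * ⟪t, (f : Tensor2 H)⟫_ℝ)] with ω h1 h2 h3 h4 h5 h6
  rw [h4, Pi.add_apply, h5, h6, h2, h3, Pi.smul_apply, Pi.smul_apply, Pi.neg_apply, neg_neg,
    inner_smul_left, h1]
  simp; ring

/-- `Γ_r(I₂(f)) = 2^r I₂(f^{r+1}) + c`, with powers taken in the sense of operators. -/
lemma exists_gam_eq [IsProbabilityMeasure P] (hX : IsIsonormal X P) (hF : IsI2 X P f F) (r : ℕ) :
    ∃ c : ℝ, Gam X P F r =
      (2 : ℝ) ^ r • hX.doubleIntegral (gammaKernel f r) + Lp.const 2 P c := by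
  induction r with
  | zero => exact ⟨0, by simpa [Gam, gammaKernel] using (hX.eq_doubleIntegral hF).1⟩
  | succ r ih =>
    obtain ⟨c, hc⟩ := ih
    have h := hX.gammaStep_ae_eq hF (swap_gammaKernel (swap_of_mem_symTensor2 f) r).1 (2 ^ r) c
    rw [← hc] at h
    have hm : MemLp (gammaStep X P F (Gam X P F r)) 2 P := (Lp.memLp _).ae_eq h.symm
    refine ⟨2 * 2 ^ r * ⟪gammaKernel (f : Tensor2 H) r, (f : Tensor2 H)⟫_ℝ, ?_⟩
    rw [Gam, dif_pos hm, pow_succ']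
    exact Lp.ext (hm.coeFn_toLp.trans h)

lemma gamWellDefined [IsProbabilityMeasure P] (hX : IsIsonormal X P) (hF : IsI2 X P f F) :
    GamWellDefined X P F := by
  refine ⟨(hX.pseudoInverseL_mem_domain hF).1, fun r => ?_⟩
  obtain ⟨c, hc⟩ := hX.exists_gam_eq hF r
  have ht := (swap_gammaKernel (swap_of_mem_symTensor2 f) r).1
  rw [hc]
  exact ⟨(hX.malliavinDeriv_doubleIntegral_add_const ht _ c).1,
    (Lp.memLp _).ae_eq (hX.gammaStep_ae_eq hF ht _ c).symm⟩

lemma variance_gam_sub [IsProbabilityMeasure P] (hX : IsIsonormal X P) (hF : IsI2 X P f F)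
    (r : ℕ) :
    Var[fun ω => Gam X P F (r + 1) ω - 2 * Gam X P F r ω; P] =
      2 * 4 ^ (r + 1) * ‖gammaKernel (f : Tensor2 H) (r + 1) - gammaKernel f r‖ ^ 2 := by
  obtain ⟨c, hc⟩ := hX.exists_gam_eq hF r
  obtain ⟨d, hd⟩ := hX.exists_gam_eq hF (r + 1)
  have hs := fun k => (swap_gammaKernel (swap_of_mem_symTensor2 f) k).1
  set u := gammaKernel (f : Tensor2 H) (r + 1)
  set v := gammaKernel (f : Tensor2 H) r
  have ht : swap H ((2 : ℝ) ^ (r + 1) • (u - v)) = (2 : ℝ) ^ (r + 1) • (u - v) := by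
    rw [map_smul, map_sub, hs, hs]
  rw [hX.variance_of_ae_eq_doubleIntegral_add_const ht (c := d - 2 * c), norm_smul, mul_pow,
    norm_pow, ← pow_mul, mul_comm (r + 1) 2, pow_mul]
  · norm_num [mul_assoc]
  · have e : Gam X P F (r + 1) - (2 : ℝ) • Gam X P F r =
        hX.doubleIntegral ((2 : ℝ) ^ (r + 1) • (u - v)) + Lp.const 2 P (d - 2 * c) := by
      have hk : Lp.const 2 P (d - 2 * c) = Lp.const 2 P d - (2 : ℝ) • Lp.const 2 P c := by
        rw [map_sub]; congr 1
      rw [hc, hd, hk, map_smul, map_sub, pow_succ']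
      module
    have e' := Lp.coeFn_sub (Gam X P F (r + 1)) ((2 : ℝ) • Gam X P F r)
    rw [e] at e'
    filter_upwards [e', Lp.coeFn_smul (2 : ℝ) (Gam X P F r),
      Lp.coeFn_add (hX.doubleIntegral ((2 : ℝ) ^ (r + 1) • (u - v))) (Lp.const 2 P (d - 2 * c)),
      Lp.coeFn_const 2 P (d - 2 * c)] with ω h1 h2 h3 h4
    rw [h3, Pi.add_apply, h4, Pi.sub_apply, h2] at h1
    simpa using h1.symm

end IsIsonormal

end WienerChaos

end

theorem mainTheorem9
    {H : Type*} [NormedAddCommGroup H] [InnerProductSpace ℝ H] [CompleteSpace H]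
    [TopologicalSpace.SeparableSpace H]
    {Ω : Type*} [MeasurableSpace Ω] (P : Measure Ω) [IsProbabilityMeasure P]
    (X : H → Ω → ℝ) (hX : WienerChaos.IsIsonormal X P)
    (f : WienerChaos.symTensor2 H) (F : Lp ℝ 2 P) (hF : WienerChaos.IsI2 X P f F)
    (ν : ℝ) (hν : 0 < ν) (hvar : ∫ ω, (F ω) ^ 2 ∂P = 2 * ν) :
    WienerChaos.GamWellDefined X P F ∧
    (∀ r : ℕ, 1 ≤ r →
      Var[fun ω => WienerChaos.Gam X P F (r + 1) ω - 2 * WienerChaos.Gam X P F r ω; P] ≤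
        (4 * ν) *
          Var[fun ω => WienerChaos.Gam X P F r ω - 2 * WienerChaos.Gam X P F (r - 1) ω; P]) ∧
    Var[fun ω => WienerChaos.Gam X P F 2 ω - 2 * WienerChaos.Gam X P F 1 ω; P] ≤
      (4 * ν) * Var[fun ω => WienerChaos.Gam X P F 1 ω - 2 * F ω; P] ∧
    (∀ r : ℕ, 1 ≤ r →
      Var[fun ω => WienerChaos.Gam X P F (r + 1) ω - 2 * WienerChaos.Gam X P F r ω; P] ≤
        (4 * ν) ^ r * Var[fun ω => WienerChaos.Gam X P F 1 ω - 2 * F ω; P]) := by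
  have hnorm : ‖(f : WienerChaos.Tensor2 H)‖ ^ 2 = ν := by
    rw [(hX.eq_doubleIntegral hF).1,
      hX.integral_doubleIntegral_sq (WienerChaos.swap_of_mem_symTensor2 f)] at hvar
    linarith
  have step : ∀ r : ℕ,
      Var[fun ω => WienerChaos.Gam X P F (r + 2) ω - 2 * WienerChaos.Gam X P F (r + 1) ω; P] ≤
        (4 * ν) *
          Var[fun ω => WienerChaos.Gam X P F (r + 1) ω - 2 * WienerChaos.Gam X P F r ω; P] := by
    intro r
    rw [hX.variance_gam_sub hF, hX.variance_gam_sub hF, ← hnorm]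
    have h := pow_le_pow_left₀ (norm_nonneg _)
      (WienerChaos.norm_gammaKernel_sub_le (f : WienerChaos.Tensor2 H) r) 2
    rw [mul_pow] at h
    have := mul_le_mul_of_nonneg_left h (by positivity : (0 : ℝ) ≤ 2 * 4 ^ (r + 2))
    refine this.trans_eq ?_
    ring
  have iter : ∀ r : ℕ,
      Var[fun ω => WienerChaos.Gam X P F (r + 1) ω - 2 * WienerChaos.Gam X P F r ω; P] ≤
        (4 * ν) ^ r * Var[fun ω => WienerChaos.Gam X P F 1 ω - 2 * F ω; P] := by
    intro r
    induction r with
    | zero => simp [WienerChaos.Gam]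
    | succ r ih =>
      rw [pow_succ', mul_assoc (4 * ν)]
      exact (step r).trans (mul_le_mul_of_nonneg_left ih (by positivity))
  refine ⟨hX.gamWellDefined hF, fun r hr => ?_, step 0, fun r _ => iter r⟩
  obtain ⟨r, rfl⟩ := Nat.exists_eq_add_of_le' hr
  exact step r
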